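/- Let $K$ be a field, $\varphi : K \to K$ a ring endomorphism, $K_0=\{x\in K : \varphi(x)=x\}$, and let $R=K[t;\varphi]$ be the ring of finite formal sums $\sum_i t^i a_i$ ($a_i\in K$) with termwise addition and the commutation rule $at=t\varphi(a)$. Modules are right $R$-modules, in the language $\{0,+,-\}\cup\{\cdot r : r\in R\}$. A module $M$ is divisible if $M.r=M$ for all $r\in R\setminus\{0\}$, and $\mathrm{ann}_M(q)=\{x\in M : x.q=0\}$. Two irreducible elements $r,q$ of $R$ are $K$-conjugate if $q=\lambda r\mu$ with $\lambda,\mu\in K\setminus\{0\}$. Fix a set $\mathcal P$ of representatives of the irreducible elements of $R$ modulo $K$-conjugation. A completion of a theory is a maximal consistent theory containing it. For $f:\mathcal P\to\mathbb N\cup\{\infty\}$ let $T_f$ be the theory of nonzero divisible $R$-modules $M$ with $|\mathrm{ann}_M(q)|=f(q)$ for all $q\in\mathcal P$ (all infinite cardinals being identified with $\infty$). The completions of the theory of nonzero divisible $R$-modules are obtained by specifying, for each $q\in\mathcal P$, $|\mathrm{ann}(q)|\in\{|K_0|^n : n\in\mathbb N\}\cup\{\infty\}$, and they eliminate quantifiers.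 Precisely: 1. Every completion $T$ of the theory of nonzero divisible $R$-modules eliminates quantifiers, and there is exactly one $f:\mathcal P\to\mathbb N\cup\{\infty\}$ such that $f(q)\in\{|K_0|^n : n\in\mathbb N\}\cup\{\infty\}$ for all $q\in\mathcal P$ and $T$ is the set of consequences of $T_f$. 2. Conversely, for every $f:\mathcal P\to\mathbb N\cup\{\infty\}$ such that $T_f$ is consistent, the set of consequences of $T_f$ is a completion of the theory of nonzero divisible $R$-modules. 3. The specifications that occur are the following: $T_f$ is consistent if and only if $f(q)\in\{|\mathrm{End}_R(R/qR)|^n : n\in\mathbb N\}\cup\{\infty\}$ for all $q\in\mathcal P$, and $f(q)=f(q')$ for all $q,q'\in\mathcal P$ such that $R/qR$ and $R/q'R$ are isomorphic $R$-modules. -/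

import Mathlib

open FirstOrder FirstOrder.Language

universe u v w

/-! ### The ring of twisted polynomials -/

namespace TwistedPolyAux

variable {K : Type u} [Field K] (φ : K →+* K)

/-- The biadditive product of finite formal sums with `(tᵏ a) (tˡ b) = tᵏ⁺ˡ φˡ(a) b`. -/
noncomputable def mul (p q : ℕ →₀ K) : ℕ →₀ K :=
  p.sum fun k a => q.sum fun l b => Finsupp.single (k + l) (φ^[l] a * b)

theorem add_mul (p q r : ℕ →₀ K) : mul φ (p + q) r = mul φ p r + mul φ q r := by
  refine Finsupp.sum_add_index' ?_ ?_
  · intro k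
    simp [iterate_map_zero]
  · intro k a b
    simp [iterate_map_add, _root_.add_mul, Finsupp.single_add, Finsupp.sum_add]

theorem mul_add (p q r : ℕ →₀ K) : mul φ p (q + r) = mul φ p q + mul φ p r := by
  unfold mul
  rw [← Finsupp.sum_add]
  refine Finsupp.sum_congr fun k _ => Finsupp.sum_add_index' ?_ ?_
  · simp
  · simp [_root_.mul_add, Finsupp.single_add]

theorem zero_mul (p : ℕ →₀ K) : mul φ 0 p = 0 := by simp [mul]

theorem mul_zero (p : ℕ →₀ K) : mul φ p 0 = 0 := by simp [mul]

theorem single_mul_single (k l : ℕ) (a b : K) :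
    mul φ (Finsupp.single k a) (Finsupp.single l b) = Finsupp.single (k + l) (φ^[l] a * b) := by
  unfold mul
  rw [Finsupp.sum_single_index, Finsupp.sum_single_index]
  · simp
  · simp [iterate_map_zero]

theorem one_mul (p : ℕ →₀ K) : mul φ (Finsupp.single 0 1) p = p := by
  induction p using Finsupp.induction_linear with
  | zero => exact mul_zero φ _
  | add p q hp hq => rw [mul_add, hp, hq]
  | single i a => rw [single_mul_single, iterate_map_one, zero_add, _root_.one_mul]

theorem mul_one (p : ℕ →₀ K) : mul φ p (Finsupp.single 0 1) = p := by
  induction p using Finsupp.induction_linear with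
  | zero => exact zero_mul φ _
  | add p q hp hq => rw [add_mul, hp, hq]
  | single i a => rw [single_mul_single, Function.iterate_zero, id, add_zero, _root_.mul_one]

theorem mul_assoc (p q r : ℕ →₀ K) : mul φ (mul φ p q) r = mul φ p (mul φ q r) := by
  induction p using Finsupp.induction_linear with
  | zero => simp only [zero_mul]
  | add p p' hp hp' => simp only [add_mul, hp, hp']
  | single i a =>
  induction q using Finsupp.induction_linear with
  | zero => simp only [zero_mul, mul_zero]
  | add p p' hp hp' => simp only [add_mul, mul_add, hp, hp']
  | single j b =>
  induction r using Finsupp.induction_linear with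
  | zero => simp only [mul_zero]
  | add p p' hp hp' => simp only [mul_add, hp, hp']
  | single l c =>
  simp only [single_mul_single, add_assoc, iterate_map_mul, _root_.mul_assoc]
  rw [← Function.iterate_add_apply, add_comm l j]

/-- The coefficients of a product: `cᵢ = ∑_{k+l=i} φˡ(aₖ) bₗ`. -/
theorem mul_apply (p q : ℕ →₀ K) (i : ℕ) :
    mul φ p q i = ∑ kl ∈ Finset.HasAntidiagonal.antidiagonal i, φ^[kl.2] (p kl.1) * q kl.2 := by
  induction p using Finsupp.induction_linear with
  | zero => simp [zero_mul, iterate_map_zero]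
  | add p p' hp hp' =>
    simp only [add_mul, Finsupp.add_apply, hp, hp', iterate_map_add, _root_.add_mul,
      Finset.sum_add_distrib]
  | single k a =>
  induction q using Finsupp.induction_linear with
  | zero => simp [mul_zero]
  | add p p' hp hp' =>
    simp only [mul_add, Finsupp.add_apply, hp, hp', _root_.mul_add, Finset.sum_add_distrib]
  | single l b =>
  rw [single_mul_single, Finsupp.single_apply]
  split_ifs with h
  · rw [Finset.sum_eq_single (k, l)]
    · simp
    · rintro ⟨k', l'⟩ _ hne
      by_cases hk : k = k'
      · have hl : l ≠ l' := fun hl => hne (by rw [hk, hl])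
        simp [Finsupp.single_apply, hl]
      · simp [Finsupp.single_apply, hk, iterate_map_zero]
    · intro hn
      exact absurd (Finset.HasAntidiagonal.mem_antidiagonal.2 h) hn
  · refine (Finset.sum_eq_zero ?_).symm
    rintro ⟨k', l'⟩ hkl
    rw [Finset.HasAntidiagonal.mem_antidiagonal] at hkl
    by_cases hk : k = k'
    · have hl : l ≠ l' := fun hl => h (by rw [hk, hl]; exact hkl)
      simp [Finsupp.single_apply, hl]
    · simp [Finsupp.single_apply, hk, iterate_map_zero]

end TwistedPolyAux

/-- The set of formal sums `∑ tⁱ aᵢ` with finitely many nonzero coefficients `aᵢ ∈ K`;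
such a sum is stored as the function `i ↦ aᵢ`. -/
def TwistedPoly {K : Type u} [Field K] (_φ : K →+* K) : Type u := ℕ →₀ K

namespace TwistedPoly

variable {K : Type u} [Field K] (φ : K →+* K)

noncomputable instance instAddCommGroup : AddCommGroup (TwistedPoly φ) :=
  inferInstanceAs (AddCommGroup (ℕ →₀ K))

/-- The ring `R = K[t; φ]`: addition is termwise and `(tᵏ a) (tˡ b) = tᵏ⁺ˡ φˡ(a) b`. -/
noncomputable instance instRing : Ring (TwistedPoly φ) :=
  { instAddCommGroup φ with
    mul := TwistedPolyAux.mul φ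
    one := (Finsupp.single 0 1 : ℕ →₀ K)
    left_distrib := TwistedPolyAux.mul_add φ
    right_distrib := TwistedPolyAux.add_mul φ
    zero_mul := TwistedPolyAux.zero_mul φ
    mul_zero := TwistedPolyAux.mul_zero φ
    one_mul := TwistedPolyAux.one_mul φ
    mul_one := TwistedPolyAux.mul_one φ
    mul_assoc := TwistedPolyAux.mul_assoc φ }

/-- The coefficient `aᵢ` of `∑ tⁱ aᵢ`. -/
def coeff {φ : K →+* K} (p : TwistedPoly φ) (i : ℕ) : K := (show ℕ →₀ K from p) i

/-- The monomial `tⁱ a`. -/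
noncomputable def monomial (i : ℕ) (a : K) : TwistedPoly φ := (Finsupp.single i a : ℕ →₀ K)

/-- The coefficients of a product: `cᵢ = ∑_{k+l=i} φˡ(aₖ) bₗ`. -/
theorem coeff_mul (p q : TwistedPoly φ) (i : ℕ) :
    (p * q).coeff i = ∑ kl ∈ Finset.HasAntidiagonal.antidiagonal i, φ^[kl.2] (p.coeff kl.1) * q.coeff kl.2 :=
  TwistedPolyAux.mul_apply φ p q i

/-- Two polynomials are `K`-conjugate if `q = λ r μ` with `λ, μ ∈ K ∖ {0}`. -/
def KConj {φ : K →+* K} (r q : TwistedPoly φ) : Prop :=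
  ∃ a b : K, a ≠ 0 ∧ b ≠ 0 ∧ q = monomial φ 0 a * r * monomial φ 0 b

/-- `P` is a set of representatives of the irreducible polynomials modulo `K`-conjugation. -/
def IsSetOfRepresentatives {φ : K →+* K} (P : Set (TwistedPoly φ)) : Prop :=
  (∀ p ∈ P, Irreducible p) ∧ ∀ q : TwistedPoly φ, Irreducible q → ∃! p, p ∈ P ∧ KConj p q

/-- The set `{|K₀|ⁿ : n ∈ ℕ} ∪ {∞}`, where `K₀` is the fixed field of `φ`. -/
noncomputable def fixedFieldPowers : Set ℕ∞ :=
  {c | ∃ n : ℕ, c = ENat.card {x : K // φ x = x} ^ n} ∪ {⊤}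

/-- The right module `R / qR`. -/
abbrev CyclicModule {φ : K →+* K} (q : TwistedPoly φ) : Type u :=
  TwistedPoly φ ⧸ Submodule.span (TwistedPoly φ)ᵐᵒᵖ {q}

end TwistedPoly

/-! ### The first-order language of right modules -/

/-- Function symbols `0`, `-`, `+` and, for each `s ∈ S`, the unary symbol `.s`. -/
inductive RightModuleFunc (S : Type u) : ℕ → Type u
  | zero : RightModuleFunc S 0
  | neg : RightModuleFunc S 1
  | add : RightModuleFunc S 2
  | act (s : S) : RightModuleFunc S 1

/-- The language `{0, +, -} ∪ {.s | s ∈ S}` of right `S`-modules. -/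
def rightModuleLang (S : Type u)   : FirstOrder.Language.{u, 0} where
  Functions := RightModuleFunc S
  Relations := fun _ => Empty

namespace RightModuleLang

variable {S : Type u} {α : Type v}

def zeroTerm : (rightModuleLang S).Term α :=
  Constants.term (L := rightModuleLang S) RightModuleFunc.zero

def negTerm (x : (rightModuleLang S).Term α) : (rightModuleLang S).Term α :=
  Functions.apply₁ (L := rightModuleLang S) RightModuleFunc.neg x

def addTerm (x y : (rightModuleLang S).Term α) : (rightModuleLang S).Term α :=
  Functions.apply₂ (L := rightModuleLang S) RightModuleFunc.add x y

def actTerm (x : (rightModuleLang S).Term α) (s : S) : (rightModuleLang S).Term α :=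
  Functions.apply₁ (L := rightModuleLang S) (RightModuleFunc.act s) x

variable (S)

/-- The axioms of right `S`-modules. -/
def moduleTheory [Ring S] : (rightModuleLang S).Theory :=
  {∀' ∀' ∀' (addTerm (addTerm (&0) (&1)) (&2) =' addTerm (&0) (addTerm (&1) (&2))),
    ∀' ∀' (addTerm (&0) (&1) =' addTerm (&1) (&0)),
    ∀' (addTerm (&0) zeroTerm =' &0),
    ∀' (addTerm (&0) (negTerm (&0)) =' zeroTerm),
    ∀' (actTerm (&0) 1 =' &0)} ∪
  {σ | ∃ s : S, σ =
    ∀' ∀' (actTerm (addTerm (&0) (&1)) s =' addTerm (actTerm (&0) s) (actTerm (&1) s))} ∪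
  {σ | ∃ r s : S, σ =
    ∀' (actTerm (&0) (r + s) =' addTerm (actTerm (&0) r) (actTerm (&0) s))} ∪
  {σ | ∃ r s : S, σ = ∀' (actTerm (&0) (r * s) =' actTerm (actTerm (&0) r) s)}

/-- The theory of divisible right `S`-modules: for every `r ≠ 0`, each element is of the
form `y.r`. -/
def divisibleTheory [Ring S] : (rightModuleLang S).Theory :=
  moduleTheory S ∪ {σ | ∃ r : S, r ≠ 0 ∧ σ = ∀' ∃' (actTerm (&1) r =' &0)}

/-- The theory of nonzero divisible right `S`-modules. -/
def nonzeroDivisibleTheory [Ring S] : (rightModuleLang S).Theory :=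
  divisibleTheory S ∪ {∃' ∼(&0 =' zeroTerm)}

variable {S}

/-- The sentence `∃ x₁ … xₙ` pairwise distinct with `xᵢ.q = 0`, that is `|ann(q)| ≥ n`. -/
noncomputable def annGe (q : S) (n : ℕ) : (rightModuleLang S).Sentence :=
  BoundedFormula.exs
    (BoundedFormula.iInf (fun i : Fin n => (actTerm (&i) q =' zeroTerm)) ⊓
      BoundedFormula.iInf (fun ij : {ij : Fin n × Fin n // ij.1 ≠ ij.2} =>
        ∼(&ij.1.1 =' &ij.1.2)))

/-- The theory of nonzero divisible modules in which `|ann(q)| = f q` for all `q ∈ P`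
(infinite cardinals are not distinguished). -/
def specifiedTheory [Ring S] (P : Set S) (f : P → ℕ∞) : (rightModuleLang S).Theory :=
  nonzeroDivisibleTheory S ∪
  {σ | ∃ (q : P) (n : ℕ), (n : ℕ∞) ≤ f q ∧ σ = annGe (q : S) n} ∪
  {σ | ∃ (q : P) (n : ℕ), f q < (n : ℕ∞) ∧ σ = ∼(annGe (q : S) n)}

/-! The next facts check the axioms against the usual right modules, that is, against
`Module Sᵐᵒᵖ M`. -/

section Semantics

variable [Ring S] (M : Type w) [AddCommGroup M] [Module Sᵐᵒᵖ M]

/-- A right `S`-module as a structure for the language of right `S`-modules. -/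
@[reducible] def toStructure : (rightModuleLang S).Structure M where
  funMap := fun f v => match f with
    | RightModuleFunc.zero => 0
    | RightModuleFunc.neg => -v 0
    | RightModuleFunc.add => v 0 + v 1
    | RightModuleFunc.act s => MulOpposite.op s • v 0
  RelMap := fun r _ => nomatch r

theorem realize_zeroTerm (v : α → M) :
    letI := toStructure (S := S) M
    (zeroTerm : (rightModuleLang S).Term α).realize v = 0 := rfl

theorem realize_negTerm (x : (rightModuleLang S).Term α) (v : α → M) :
    letI := toStructure (S := S) M
    (negTerm x).realize v = -x.realize v := rfl

theorem realize_addTerm (x y : (rightModuleLang S).Term α) (v : α → M) :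
    letI := toStructure (S := S) M
    (addTerm x y).realize v = x.realize v + y.realize v := rfl

theorem realize_actTerm (x : (rightModuleLang S).Term α) (s : S) (v : α → M) :
    letI := toStructure (S := S) M
    (actTerm x s).realize v = MulOpposite.op s • x.realize v := rfl

theorem models_moduleTheory :
    letI := toStructure (S := S) M
    M ⊨ moduleTheory S := by
  let _ := toStructure (S := S) M
  rw [Theory.model_iff]
  rintro σ (((h | ⟨s, rfl⟩) | ⟨r, s, rfl⟩) | ⟨r, s, rfl⟩)
  · rcases h with rfl | rfl | rfl | rfl | rfl <;>
    simp [Sentence.Realize, Formula.Realize, realize_addTerm, realize_negTerm, realize_actTerm,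
      realize_zeroTerm, add_assoc, Fin.snoc]
    intro a b
    exact add_comm a b
  · simp [Sentence.Realize, Formula.Realize, realize_addTerm, realize_actTerm, Fin.snoc]
  · simp [Sentence.Realize, Formula.Realize, realize_addTerm, realize_actTerm, Fin.snoc,
      add_smul]
  · simp [Sentence.Realize, Formula.Realize, realize_actTerm, Fin.snoc, mul_smul]

theorem models_nonzeroDivisibleTheory_iff :
    letI := toStructure (S := S) M
    M ⊨ nonzeroDivisibleTheory S ↔
      Nontrivial M ∧ ∀ r : S, r ≠ 0 → ∀ x : M, ∃ y : M, MulOpposite.op r • y = x := by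
  let _ := toStructure (S := S) M
  have hm := models_moduleTheory (S := S) M
  have hd : ∀ r : S, M ⊨ (∀' ∃' (actTerm (&1) r =' &0) : (rightModuleLang S).Sentence) ↔
      ∀ x : M, ∃ y : M, MulOpposite.op r • y = x := fun r => by
    simp [Sentence.Realize, Formula.Realize, realize_actTerm, Fin.snoc]
  have hn : M ⊨ (∃' ∼(&0 =' zeroTerm) : (rightModuleLang S).Sentence) ↔ ∃ x : M, x ≠ 0 := by
    simp [Sentence.Realize, Formula.Realize, realize_zeroTerm, Fin.snoc]
  rw [nontrivial_iff_exists_ne (0 : M), ← hn]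
  simp only [nonzeroDivisibleTheory, divisibleTheory, Theory.model_union_iff,
    Theory.model_singleton_iff]
  constructor
  · rintro ⟨⟨-, h⟩, h'⟩
    exact ⟨h', fun r hr => (hd r).1 (Theory.model_iff _ |>.1 h _ ⟨r, hr, rfl⟩)⟩
  · rintro ⟨h', h⟩
    refine ⟨⟨hm, (Theory.model_iff _).2 ?_⟩, h'⟩
    rintro σ ⟨r, hr, rfl⟩
    exact (hd r).2 (h r hr)

theorem realize_annGe (q : S) (n : ℕ) :
    letI := toStructure (S := S) M
    M ⊨ annGe q n ↔ (n : ℕ∞) ≤ ENat.card {x : M // MulOpposite.op q • x = 0} := by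
  let _ := toStructure (S := S) M
  have h : M ⊨ annGe q n ↔ ∃ xs : Fin n → M,
      (∀ i, MulOpposite.op q • xs i = 0) ∧ ∀ i j, i ≠ j → xs i ≠ xs j := by
    simp [annGe, Sentence.Realize, BoundedFormula.realize_exs, realize_actTerm, realize_zeroTerm]
  rw [h, ENat.card, Cardinal.natCast_le_toENat, ← Cardinal.lift_mk_fin,
    ← Cardinal.lift_id'.{0} (Cardinal.mk {x : M // MulOpposite.op q • x = 0}),
    Cardinal.lift_mk_le']
  constructor
  · rintro ⟨xs, h1, h2⟩
    refine ⟨⟨fun i => ⟨xs i, h1 i⟩, fun i j hij => ?_⟩⟩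
    by_contra hne
    exact h2 i j hne (congrArg Subtype.val hij)
  · rintro ⟨e⟩
    exact ⟨fun i => (e i).1, fun i => (e i).2,
      fun i j hij he => hij (e.injective (Subtype.ext he))⟩

end Semantics

end RightModuleLang

/-! ### Completions and quantifier elimination -/

section ModelTheory

variable {L : FirstOrder.Language.{u, v}}

/-- The set of sentences that follow from `T`. -/
def consequences (T : L.Theory) : L.Theory := {σ | T ⊨ᵇ σ}

/-- A completion of `T` is a satisfiable theory that contains `T` and, for every sentence,
either the sentence or its negation. -/
def IsCompletion (T T' : L.Theory) : Prop := T ⊆ T' ∧ T'.IsMaximal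

/-- Modulo `T`, every formula is equivalent to a quantifier-free one in the same variables. -/
def HasQE (T : L.Theory) : Prop :=
  ∀ (n : ℕ) (ψ : L.Formula (Fin n)), ∃ χ : L.Formula (Fin n), χ.IsQF ∧ (ψ ⇔[T] χ)

end ModelTheory

/-! ### Arithmetic of $R$: degree, right division, common multiples, irreducible elements -/

namespace TwistedPoly

variable {K : Type u} [Field K] {φ : K →+* K}

/-! Division with remainder holds in $R$ on the side that makes every right ideal principal,
whatever $\varphi$ is. Hence $R$ is a domain in which nonzero elements have common right multiples,
nonzero elements factor into units and irreducibles, and $R/qR$ is simple for irreducible $q$.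
Everything else rests on these facts.

Quantifier elimination and completeness come from a back-and-forth. Given nonzero divisible $M$, $N$
with equal annihilator sizes at irreducibles and an isomorphism between submodules, any $b\in M$ can
be added to its domain after replacing $N$ by an elementary extension (`IsPartialIso.extendsTo`). If
no nonzero multiple of $b$ lies in the domain, an image is needed that is just as free over $N$;
divisibility and an ultrapower supply it. Otherwise $b.r$ is in the domain for some $r\ne 0$, and
factoring $r$ reduces to irreducible $r=q$ (`extendsTo_of_irreducible`). There the image must be a
solution of $x.q=n$ outside the range: if $\mathrm{ann}_N(q)$ is infinite an ultrapower has one, and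
if it is finite, counting shows that the range cannot exhaust the solutions unless $b$ was already
in the domain. So all formulas are preserved by partial isomorphisms (`isPreserved`). The zero
isomorphism gives completeness; the isomorphism generated by two tuples of the same quantifier-free
type gives quantifier elimination.

For the values of $f$: $\mathrm{ann}_M(q)\cong\mathrm{Hom}(R/qR,M)$ is a vector space over the
division ring $\mathrm{End}(R/qR)$ and depends only on the isomorphism class of $R/qR$; it is also a
space over $K_0$, whose elements are central in $R$. Conversely, a product of powers of the simple
modules, together with $R$, has the prescribed annihilators, and it embeds in a divisible module
with no new elements killed by irreducibles (`exists_divisible_extension_annCard`). -/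

@[ext]
theorem ext {p q : TwistedPoly φ} (h : ∀ i, p.coeff i = q.coeff i) : p = q :=
  Finsupp.ext h

@[simp]
theorem coeff_zero (i : ℕ) : (0 : TwistedPoly φ).coeff i = 0 := rfl

@[simp]
theorem coeff_sub (p q : TwistedPoly φ) (i : ℕ) : (p - q).coeff i = p.coeff i - q.coeff i := rfl

theorem coeff_monomial (i : ℕ) (a : K) (j : ℕ) :
    (monomial φ i a).coeff j = if i = j then a else 0 := Finsupp.single_apply

theorem monomial_mul_monomial (k l : ℕ) (a b : K) :
    monomial φ k a * monomial φ l b = monomial φ (k + l) (φ^[l] a * b) :=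
  TwistedPolyAux.single_mul_single φ k l a b

theorem one_eq_monomial : (1 : TwistedPoly φ) = monomial φ 0 1 := rfl

/-- The degree of a twisted polynomial, with value `0` at `0`. -/
noncomputable def natDegree (p : TwistedPoly φ) : ℕ :=
  (show ℕ →₀ K from p).support.sup id

theorem le_natDegree {p : TwistedPoly φ} {i : ℕ} (h : p.coeff i ≠ 0) : i ≤ p.natDegree :=
  Finset.le_sup (f := id) (Finsupp.mem_support_iff.2 h)

theorem coeff_eq_zero {p : TwistedPoly φ} {i : ℕ} (h : p.natDegree < i) : p.coeff i = 0 := by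
  by_contra hne
  exact absurd (le_natDegree hne) (not_le.2 h)

theorem leadingCoeff_ne_zero {p : TwistedPoly φ} (h : p ≠ 0) : p.coeff p.natDegree ≠ 0 := by
  have hs : (show ℕ →₀ K from p).support.Nonempty := Finsupp.support_nonempty_iff.2 h
  obtain ⟨i, hi, he⟩ := Finset.exists_mem_eq_sup _ hs id
  have : p.natDegree = i := he
  rw [this]
  exact Finsupp.mem_support_iff.1 hi

theorem natDegree_lt {p : TwistedPoly φ} (hp : p ≠ 0) {n : ℕ} (h : ∀ i, n ≤ i → p.coeff i = 0) :
    p.natDegree < n := by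
  by_contra hn
  exact leadingCoeff_ne_zero hp (h _ (not_lt.1 hn))

theorem iterate_ne_zero {a : K} (h : a ≠ 0) (n : ℕ) : φ^[n] a ≠ 0 := by
  intro h0
  apply h
  have := iterate_map_zero φ n
  exact (φ.injective.iterate n) (h0.trans this.symm)

/-- Only the pair of top degrees contributes. As $\varphi$ is injective, the value is nonzero for
nonzero factors, so degrees add and $R$ is a domain. -/
theorem coeff_mul_natDegree (p q : TwistedPoly φ) :
    (p * q).coeff (p.natDegree + q.natDegree) =
      φ^[q.natDegree] (p.coeff p.natDegree) * q.coeff q.natDegree := by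
  rw [coeff_mul, Finset.sum_eq_single (p.natDegree, q.natDegree)]
  · rintro ⟨k, l⟩ hkl hne
    rw [Finset.HasAntidiagonal.mem_antidiagonal] at hkl
    simp only at hkl ⊢
    rcases lt_trichotomy k p.natDegree with h | h | h
    · rw [coeff_eq_zero (p := q) (by omega), MulZeroClass.mul_zero]
    · exact absurd (Prod.ext h (by simp only; omega)) hne
    · rw [coeff_eq_zero h, iterate_map_zero, MulZeroClass.zero_mul]
  · intro h
    have hm : (p.natDegree, q.natDegree) ∈
        Finset.HasAntidiagonal.antidiagonal (p.natDegree + q.natDegree) :=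
      Finset.HasAntidiagonal.mem_antidiagonal.2 rfl
    exact absurd hm h

theorem coeff_mul_eq_zero {p q : TwistedPoly φ} {i : ℕ} (h : p.natDegree + q.natDegree < i) :
    (p * q).coeff i = 0 := by
  rw [coeff_mul]
  refine Finset.sum_eq_zero ?_
  rintro ⟨k, l⟩ hkl
  rw [Finset.HasAntidiagonal.mem_antidiagonal] at hkl
  simp only at hkl ⊢
  rcases lt_or_ge p.natDegree k with h' | h'
  · rw [coeff_eq_zero h', iterate_map_zero, MulZeroClass.zero_mul]
  · rw [coeff_eq_zero (p := q) (by omega), MulZeroClass.mul_zero]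

instance : Nontrivial (TwistedPoly φ) :=
  ⟨⟨1, 0, fun h => by
    have := congrArg (fun p => coeff p 0) h
    simp [one_eq_monomial, coeff_monomial] at this⟩⟩

instance : NoZeroDivisors (TwistedPoly φ) where
  eq_zero_or_eq_zero_of_mul_eq_zero := by
    intro p q h
    by_contra! hne
    have := coeff_mul_natDegree p q
    rw [h, coeff_zero] at this
    exact mul_ne_zero (iterate_ne_zero (leadingCoeff_ne_zero hne.1) _)
      (leadingCoeff_ne_zero hne.2) this.symm

instance : IsDomain (TwistedPoly φ) := NoZeroDivisors.to_isDomain _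

theorem natDegree_mul {p q : TwistedPoly φ} (hp : p ≠ 0) (hq : q ≠ 0) :
    (p * q).natDegree = p.natDegree + q.natDegree := by
  refine le_antisymm ?_ (le_natDegree ?_)
  · exact Nat.lt_succ_iff.1 (natDegree_lt (mul_ne_zero hp hq) fun i hi => coeff_mul_eq_zero hi)
  · rw [coeff_mul_natDegree]
    exact mul_ne_zero (iterate_ne_zero (leadingCoeff_ne_zero hp) _) (leadingCoeff_ne_zero hq)

theorem monomial_ne_zero {i : ℕ} {a : K} (h : a ≠ 0) : monomial φ i a ≠ 0 := fun h0 => by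
  have := congrArg (fun p => coeff p i) h0
  simp [coeff_monomial, h] at this

theorem natDegree_monomial {i : ℕ} {a : K} (h : a ≠ 0) : (monomial φ i a).natDegree = i := by
  refine le_antisymm (Nat.lt_succ_iff.1 (natDegree_lt (monomial_ne_zero h) fun j hj => ?_))
    (le_natDegree (by simpa [coeff_monomial] using h))
  rw [coeff_monomial, if_neg (by omega)]

theorem monomial_zero_mul_inv {a : K} (h : a ≠ 0) :
    monomial φ 0 a * monomial φ 0 a⁻¹ = 1 := by
  rw [monomial_mul_monomial, Function.iterate_zero, id, mul_inv_cancel₀ h]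
  rfl

theorem isUnit_monomial_zero {a : K} (h : a ≠ 0) : IsUnit (monomial φ 0 a) :=
  ⟨⟨monomial φ 0 a, monomial φ 0 a⁻¹, monomial_zero_mul_inv h, by
    simpa using monomial_zero_mul_inv (φ := φ) (inv_ne_zero h)⟩, rfl⟩

theorem isUnit_of_natDegree_eq_zero {p : TwistedPoly φ} (hp : p ≠ 0) (h : p.natDegree = 0) :
    IsUnit p := by
  have h1 : p = monomial φ 0 (p.coeff 0) := by
    ext i
    rw [coeff_monomial]
    split_ifs with hi
    · rw [hi]
    · exact coeff_eq_zero (by omega)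
  have h2 := leadingCoeff_ne_zero hp
  rw [h] at h2
  rw [h1]
  exact isUnit_monomial_zero h2

/-- Every nonzero twisted polynomial is obtained from units and irreducible elements by
multiplication. -/
theorem induction_on_irreducible {motive : TwistedPoly φ → Prop}
    (unit : ∀ r, IsUnit r → motive r) (irreducible : ∀ r, Irreducible r → motive r)
    (mul : ∀ r s, r ≠ 0 → s ≠ 0 → motive r → motive s → motive (r * s))
    (p : TwistedPoly φ) (hp : p ≠ 0) : motive p := by
  induction hn : p.natDegree using Nat.strong_induction_on generalizing p with
  | _ n ih =>
  by_cases hu : IsUnit p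
  · exact unit p hu
  by_cases hi : Irreducible p
  · exact irreducible p hi
  rw [irreducible_iff] at hi
  push Not at hi
  obtain ⟨a, b, hab, ha, hb⟩ := hi hu
  have ha0 : a ≠ 0 := by
    rintro rfl
    exact hp (by rw [hab, zero_mul])
  have hb0 : b ≠ 0 := by
    rintro rfl
    exact hp (by rw [hab, mul_zero])
  have ha1 : a.natDegree ≠ 0 := fun h => ha (isUnit_of_natDegree_eq_zero ha0 h)
  have hb1 : b.natDegree ≠ 0 := fun h => hb (isUnit_of_natDegree_eq_zero hb0 h)
  have hd := natDegree_mul ha0 hb0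
  rw [← hab] at hd
  rw [hab]
  exact mul a b ha0 hb0 (ih _ (by omega) a ha0 rfl) (ih _ (by omega) b hb0 rfl)

/-- Division with remainder on the right. -/
theorem exists_eq_mul_add (p : TwistedPoly φ) {q : TwistedPoly φ} (hq : q ≠ 0) :
    ∃ s r, p = q * s + r ∧ (r = 0 ∨ r.natDegree < q.natDegree) := by
  by_cases hp : p = 0
  · exact ⟨0, 0, by rw [hp, mul_zero, add_zero], Or.inl rfl⟩
  induction hn : p.natDegree using Nat.strong_induction_on generalizing p with
  | _ n ih =>
  rcases lt_or_ge p.natDegree q.natDegree with h | h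
  · exact ⟨0, p, by rw [mul_zero, zero_add], Or.inr h⟩
  set k := p.natDegree - q.natDegree with hk
  -- The top coefficient of $q\cdot t^kc$ is $\varphi^k(\mathrm{lc}\,q)\,c$, so $c$ is found by
  -- inverting in $K$. Division on the other side would require preimages under $\varphi$.
  set c := (φ^[k] (q.coeff q.natDegree))⁻¹ * p.coeff p.natDegree with hc
  have hb : φ^[k] (q.coeff q.natDegree) ≠ 0 := iterate_ne_zero (leadingCoeff_ne_zero hq) _
  have hc0 : c ≠ 0 := mul_ne_zero (inv_ne_zero hb) (leadingCoeff_ne_zero hp)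
  have hkn : q.natDegree + k = p.natDegree := by omega
  have hmon : (monomial φ k c).coeff k = c := by rw [coeff_monomial, if_pos rfl]
  by_cases hz : p - q * monomial φ k c = 0
  · exact ⟨monomial φ k c, 0, by rw [add_zero]; exact sub_eq_zero.1 hz, Or.inl rfl⟩
  have hlt : (p - q * monomial φ k c).natDegree < n := by
    refine natDegree_lt hz fun i hi => ?_
    rw [coeff_sub]
    rcases hi.eq_or_lt with rfl | hi
    · have h1 := coeff_mul_natDegree q (monomial φ k c)
      rw [natDegree_monomial hc0, hkn, hmon, hc, mul_inv_cancel_left₀ hb] at h1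
      rw [← hn, h1, sub_self]
    · rw [coeff_eq_zero (by omega), coeff_mul_eq_zero, sub_zero]
      rw [natDegree_monomial hc0]
      omega
  obtain ⟨s, r, hs, hr⟩ := ih _ hlt _ hz rfl
  exact ⟨monomial φ k c + s, r, by rw [mul_add, add_assoc, ← hs]; abel, hr⟩

/-- Nonzero elements have a common right multiple. -/
theorem exists_mul_eq_mul {r s : TwistedPoly φ} (hr : r ≠ 0) (hs : s ≠ 0) :
    ∃ a b, r * a = s * b ∧ r * a ≠ 0 := by
  induction hn : s.natDegree using Nat.strong_induction_on generalizing r s with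
  | _ n ih =>
  obtain ⟨c, d, h, hd⟩ := exists_eq_mul_add r hs
  by_cases hd0 : d = 0
  · exact ⟨1, c, by rw [mul_one, h, hd0, add_zero], by rwa [mul_one]⟩
  -- From $r=sc+d$ and $sa=db$ it follows that $rb=s(cb+a)$.
  obtain ⟨a, b, hab, hne⟩ := ih _ (hn ▸ hd.resolve_left hd0) hs hd0 rfl
  refine ⟨b, c * b + a, ?_, mul_ne_zero hr ?_⟩
  · rw [h, add_mul, mul_add, mul_assoc, hab]
  · rintro rfl
    exact hne (by rw [hab, mul_zero])

/-- A finite family of nonzero elements has a nonzero common right multiple. -/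
theorem exists_common_multiple {ι : Type*} (F : Finset ι) (r : ι → TwistedPoly φ)
    (h : ∀ i ∈ F, r i ≠ 0) : ∃ m : TwistedPoly φ, m ≠ 0 ∧ ∀ i ∈ F, ∃ s, r i * s = m := by
  classical
  induction F using Finset.induction_on with
  | empty => exact ⟨1, one_ne_zero, by simp⟩
  | insert i F hi ih =>
    obtain ⟨m, hm, hF⟩ := ih fun j hj => h j (Finset.mem_insert_of_mem hj)
    obtain ⟨a, b, hab, hne⟩ := exists_mul_eq_mul (h i (Finset.mem_insert_self i F)) hm
    refine ⟨r i * a, hne, fun j hj => ?_⟩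
    rcases Finset.mem_insert.1 hj with rfl | hj
    · exact ⟨a, rfl⟩
    · obtain ⟨s, hs⟩ := hF j hj
      exact ⟨s * b, by rw [← mul_assoc, hs, hab]⟩

/-- Any two elements generate a principal right ideal. -/
theorem exists_gcd (r s : TwistedPoly φ) :
    ∃ d a b x y, r = d * a ∧ s = d * b ∧ d = r * x + s * y := by
  by_cases hs : s = 0
  · exact ⟨r, 1, 0, 1, 0, by simp [hs]⟩
  induction hn : s.natDegree using Nat.strong_induction_on generalizing r s with
  | _ n ih =>
  obtain ⟨c, e, h, he⟩ := exists_eq_mul_add r hs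
  by_cases he0 : e = 0
  · exact ⟨s, c, 1, 0, 1, by simp [h, he0]⟩
  obtain ⟨d, a, b, x, y, h1, h2, h3⟩ := ih _ (hn ▸ he.resolve_left he0) s e he0 rfl
  refine ⟨d, a * c + b, a, y, x - c * y, ?_, h1, ?_⟩
  · rw [h, mul_add, ← mul_assoc, ← h1, ← h2]
  · have he' : e = r - s * c := by rw [h]; abel
    rw [h3, he', sub_mul, mul_sub, mul_assoc]
    abel

/-- The right ideal generated by an irreducible element is maximal. -/
theorem exists_add_eq_one {q r : TwistedPoly φ} (hq : Irreducible q) (hr : ∀ s, r ≠ q * s) :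
    ∃ x y, r * x + q * y = 1 := by
  obtain ⟨d, a, b, x, y, h1, h2, h3⟩ := exists_gcd r q
  rcases hq.isUnit_or_isUnit h2 with hd | ⟨b, rfl⟩
  · obtain ⟨d, rfl⟩ := hd
    exact ⟨x * ↑d⁻¹, y * ↑d⁻¹, by rw [← mul_assoc, ← mul_assoc, ← add_mul, ← h3, Units.mul_inv]⟩
  · exact absurd (by rw [h1, h2, mul_assoc, Units.mul_inv_cancel_left]) (hr (↑b⁻¹ * a))

end TwistedPoly

/-! ### Model-theoretic criteria for quantifier elimination and maximality -/

section QuantifierElimination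

variable {L : FirstOrder.Language.{u, v}}

open Theory.CompleteType in
/-- If any two tuples with the same quantifier-free type satisfy the same formulas, then the theory
eliminates quantifiers. -/
theorem hasQE_of_forall_realize (T : L.Theory)
    (H : ∀ (M N : Theory.ModelType.{u, v, max u v} T) (n : ℕ) (v : Fin n → M) (w : Fin n → N),
      (∀ χ : L.Formula (Fin n), χ.IsQF → (χ.Realize v ↔ χ.Realize w)) →
        ∀ ψ : L.Formula (Fin n), ψ.Realize v → ψ.Realize w) : HasQE T := by
  intro n ψ
  let D : L.Formula (Fin n) → Set (T.CompleteType (Fin n)) :=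
    fun χ => T.typesWith (Formula.equivSentence χ)
  have hD : ∀ (M : Theory.ModelType.{u, v, max u v} T) (v : Fin n → M) (χ : L.Formula (Fin n)),
      T.typeOf v ∈ D χ ↔ χ.Realize v := fun M v χ => formula_mem_typeOf
  have hsurj : ∀ p : T.CompleteType (Fin n), ∃ (M : Theory.ModelType.{u, v, max u v} T) (v : Fin n → M),
      T.typeOf v = p := fun p => by
    obtain ⟨M, v, hv⟩ := T.exists_modelType_is_realized_in p
    exact ⟨M, v, hv⟩
  have hnot : ∀ χ p, p ∈ D χ.not ↔ p ∉ D χ := fun χ p => by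
    obtain ⟨M, v, rfl⟩ := hsurj p
    rw [hD, hD, Formula.realize_not]
  have hinf : ∀ χ χ' p, p ∈ D (χ ⊓ χ') ↔ p ∈ D χ ∧ p ∈ D χ' := fun χ χ' p => by
    obtain ⟨M, v, rfl⟩ := hsurj p
    rw [hD, hD, hD, Formula.realize_inf]
  have hsup : ∀ χ χ' p, p ∈ D (χ ⊔ χ') ↔ p ∈ D χ ∨ p ∈ D χ' := fun χ χ' p => by
    obtain ⟨M, v, rfl⟩ := hsurj p
    rw [hD, hD, hD, Formula.realize_sup]
  have htop : ∀ p, p ∈ D ⊤ := fun p => by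
    obtain ⟨M, v, rfl⟩ := hsurj p
    rw [hD]
    exact Formula.realize_top.2 trivial
  have hbot : ∀ p, p ∉ D ⊥ := fun p => by
    obtain ⟨M, v, rfl⟩ := hsurj p
    rw [hD]
    exact fun h => Formula.realize_bot.1 h
  have hclopen : ∀ χ, IsClopen (D χ) := fun χ => _root_.CompleteType.isClopen_typesWith _
  -- If every quantifier-free formula of $p$ lay in $q$, closure under negation would make their
  -- quantifier-free parts equal, and `H` would put $\psi$ in $q$.
  have hsep : ∀ p q, p ∈ D ψ → q ∉ D ψ → ∃ χ : L.Formula (Fin n), χ.IsQF ∧ p ∈ D χ ∧ q ∉ D χ := by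
    intro p q hp hq
    by_contra! hn
    obtain ⟨M, v, rfl⟩ := hsurj p
    obtain ⟨N, w, rfl⟩ := hsurj q
    refine hq ((hD _ _ _).2 (H M N n v w (fun χ hχ => ⟨fun h => ?_, fun h => ?_⟩) ψ
      ((hD _ _ _).1 hp)))
    · exact (hD _ _ _).1 (hn χ hχ ((hD _ _ _).2 h))
    · by_contra h'
      have := (hnot _ _).1 (hn χ.not hχ.not ((hnot _ _).2 fun h1 => h' ((hD _ _ _).1 h1)))
      exact this ((hD _ _ _).2 h)
  -- Compactness of the complement of $D(\psi)$: finitely many separating formulas suffice for $p$,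
  -- and their conjunction is taken. Below, compactness of $D(\psi)$ yields a finite disjunction of
  -- such conjunctions.
  have hsep' : ∀ p, p ∈ D ψ → ∃ χ : L.Formula (Fin n), χ.IsQF ∧ p ∈ D χ ∧
      ∀ q ∈ (D ψ)ᶜ, q ∉ D χ := by
    intro p hp
    refine IsCompact.induction_on (s := (D ψ)ᶜ) (hclopen ψ).compl.isClosed.isCompact
      (p := fun s => ∃ χ : L.Formula (Fin n), χ.IsQF ∧ p ∈ D χ ∧ ∀ q ∈ s, q ∉ D χ)
      ⟨⊤, BoundedFormula.IsQF.top, htop p, by simp⟩ ?_ ?_ ?_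
    · rintro s t hst ⟨χ, h1, h2, h3⟩
      exact ⟨χ, h1, h2, fun q hq => h3 q (hst hq)⟩
    · rintro s t ⟨χ, h1, h2, h3⟩ ⟨χ', h1', h2', h3'⟩
      refine ⟨χ ⊓ χ', h1.inf h1', (hinf _ _ _).2 ⟨h2, h2'⟩, ?_⟩
      rintro q (hq | hq) hqq
      · exact h3 q hq ((hinf _ _ _).1 hqq).1
      · exact h3' q hq ((hinf _ _ _).1 hqq).2
    · intro q hq
      obtain ⟨χ, h1, h2, h3⟩ := hsep p q hp hq
      exact ⟨(D χ)ᶜ, mem_nhdsWithin_of_mem_nhds ((hclopen χ).compl.isOpen.mem_nhds h3),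
        χ, h1, h2, fun q hq => hq⟩
  obtain ⟨χ, hχ, h1, h2⟩ : ∃ χ : L.Formula (Fin n), χ.IsQF ∧ (∀ p ∈ D ψ, p ∈ D χ) ∧
      ∀ q ∈ (D ψ)ᶜ, q ∉ D χ := by
    refine IsCompact.induction_on (s := D ψ) (hclopen ψ).isClosed.isCompact
      (p := fun s => ∃ χ : L.Formula (Fin n), χ.IsQF ∧ (∀ p ∈ s, p ∈ D χ) ∧
        ∀ q ∈ (D ψ)ᶜ, q ∉ D χ) ⟨⊥, BoundedFormula.isQF_bot, by simp, fun q _ => hbot q⟩ ?_ ?_ ?_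
    · rintro s t hst ⟨χ, h1, h2, h3⟩
      exact ⟨χ, h1, fun q hq => h2 q (hst hq), h3⟩
    · rintro s t ⟨χ, h1, h2, h3⟩ ⟨χ', h1', h2', h3'⟩
      refine ⟨χ ⊔ χ', h1.sup h1', ?_, fun q hq hqq => ?_⟩
      · rintro q (hq | hq)
        · exact (hsup _ _ _).2 (Or.inl (h2 q hq))
        · exact (hsup _ _ _).2 (Or.inr (h2' q hq))
      · rcases (hsup _ _ _).1 hqq with h | h
        · exact h3 q hq h
        · exact h3' q hq h
    · intro p hp
      obtain ⟨χ, h1, h2, h3⟩ := hsep' p hp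
      exact ⟨D χ, mem_nhdsWithin_of_mem_nhds ((hclopen χ).isOpen.mem_nhds h2),
        χ, h1, fun q hq => hq, h3⟩
  refine ⟨χ, hχ, Theory.models_formula_iff.2 fun M v => ?_⟩
  rw [Formula.realize_iff, ← hD, ← hD]
  exact ⟨h1 _, fun h => by_contra fun h' => h2 _ h' h⟩

/-- The consequences of a satisfiable theory whose models are elementarily equivalent form a maximal
theory. -/
theorem isMaximal_consequences {T : L.Theory} (hT : T.IsSatisfiable)
    (h : ∀ (M N : Theory.ModelType.{u, v, max u v} T) (σ : L.Sentence), M ⊨ σ → N ⊨ σ) :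
    (consequences T).IsMaximal := by
  obtain ⟨M⟩ := hT
  have hM : M ⊨ consequences T := (Theory.model_iff _).2 fun σ hσ => hσ.realize_sentence M
  refine ⟨Theory.Model.isSatisfiable M, fun σ => ?_⟩
  by_cases hσ : M ⊨ σ
  · exact Or.inl (Theory.models_sentence_iff.2 fun N => h M N σ hσ)
  · exact Or.inr (Theory.models_sentence_iff.2 fun N => h M N σ.not
      ((Sentence.realize_not M).2 hσ))

theorem subset_consequences (T : L.Theory) : T ⊆ consequences T :=
  fun _ h => Theory.models_sentence_of_mem h

/-- A maximal theory consists of the sentences that hold in any of its models. -/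
theorem mem_iff_realize_of_isMaximal {T : L.Theory} (hT : T.IsMaximal) (M : Type*) [L.Structure M]
    [Nonempty M] (hM : M ⊨ T) (σ : L.Sentence) : σ ∈ T ↔ M ⊨ σ := by
  refine ⟨fun h => Theory.realize_sentence_of_mem T h, fun h => ?_⟩
  refine (hT.mem_or_not_mem σ).resolve_right fun h' => ?_
  exact (Sentence.realize_not M).1 (Theory.realize_sentence_of_mem T h') h

end QuantifierElimination

/-! ### Models as modules, and ultrapowers -/

namespace RightModuleLang

attribute [local instance] toStructure

section Structure

variable {S : Type u} [Ring S]

/-- Every model of the axioms of right modules is a right module. -/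
theorem exists_eq_toStructure (M : Type w) [inst : (rightModuleLang S).Structure M]
    (h : M ⊨ moduleTheory S) :
    ∃ (_ : AddCommGroup M) (_ : Module Sᵐᵒᵖ M), inst = toStructure M := by
  let z : M := Structure.funMap (L := rightModuleLang S) RightModuleFunc.zero ![]
  let ng : M → M := fun x => Structure.funMap (L := rightModuleLang S) RightModuleFunc.neg ![x]
  let ad : M → M → M := fun x y =>
    Structure.funMap (L := rightModuleLang S) RightModuleFunc.add ![x, y]
  let ac : S → M → M := fun s x =>
    Structure.funMap (L := rightModuleLang S) (RightModuleFunc.act s) ![x]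
  have rz : ∀ {α : Type} (v : α → M), (zeroTerm : (rightModuleLang S).Term α).realize v = z := by
    intro α v
    exact Term.realize_constants
  have rn : ∀ {α : Type} (x : (rightModuleLang S).Term α) (v : α → M),
      (negTerm x).realize v = ng (x.realize v) := fun x v => Term.realize_functions_apply₁
  have ra : ∀ {α : Type} (x y : (rightModuleLang S).Term α) (v : α → M),
      (addTerm x y).realize v = ad (x.realize v) (y.realize v) :=
    fun x y v => Term.realize_functions_apply₂
  have rc : ∀ {α : Type} (x : (rightModuleLang S).Term α) (s : S) (v : α → M),
      (actTerm x s).realize v = ac s (x.realize v) := fun x s v => Term.realize_functions_apply₁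
  rw [Theory.model_iff] at h
  have h1 : ∀ x y t, ad (ad x y) t = ad x (ad y t) := by
    have := h (∀' ∀' ∀' (addTerm (addTerm (&0) (&1)) (&2) =' addTerm (&0) (addTerm (&1) (&2))))
      (by simp [moduleTheory])
    simpa [Sentence.Realize, Formula.Realize, ra, Fin.snoc] using this
  have h2 : ∀ x y, ad x y = ad y x := by
    have := h (∀' ∀' (addTerm (&0) (&1) =' addTerm (&1) (&0))) (by simp [moduleTheory])
    simpa [Sentence.Realize, Formula.Realize, ra, Fin.snoc] using this
  have h3 : ∀ x, ad x z = x := by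
    have := h (∀' (addTerm (&0) zeroTerm =' &0)) (by simp [moduleTheory])
    simpa [Sentence.Realize, Formula.Realize, ra, rz, Fin.snoc] using this
  have h4 : ∀ x, ad x (ng x) = z := by
    have := h (∀' (addTerm (&0) (negTerm (&0)) =' zeroTerm)) (by simp [moduleTheory])
    simpa [Sentence.Realize, Formula.Realize, ra, rz, rn, Fin.snoc] using this
  have h5 : ∀ x, ac 1 x = x := by
    have := h (∀' (actTerm (&0) 1 =' &0)) (by simp [moduleTheory])
    simpa [Sentence.Realize, Formula.Realize, rc, Fin.snoc] using this
  have h6 : ∀ s x y, ac s (ad x y) = ad (ac s x) (ac s y) := fun s => by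
    have := h _ (Or.inl (Or.inl (Or.inr ⟨s, rfl⟩)))
    simpa [Sentence.Realize, Formula.Realize, ra, rc, Fin.snoc] using this
  have h7 : ∀ r s x, ac (r + s) x = ad (ac r x) (ac s x) := fun r s => by
    have := h _ (Or.inl (Or.inr ⟨r, s, rfl⟩))
    simpa [Sentence.Realize, Formula.Realize, ra, rc, Fin.snoc] using this
  have h8 : ∀ r s x, ac (r * s) x = ac s (ac r x) := fun r s => by
    have := h _ (Or.inr ⟨r, s, rfl⟩)
    simpa [Sentence.Realize, Formula.Realize, ra, rc, Fin.snoc] using this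
  let _ : Add M := ⟨ad⟩
  let _ : Zero M := ⟨z⟩
  let _ : Neg M := ⟨ng⟩
  let g : AddCommGroup M :=
    { AddGroup.ofLeftAxioms h1 (fun x => (h2 z x).trans (h3 x))
        (fun x => (h2 _ x).trans (h4 x)) with add_comm := h2 }
  have e6 : ∀ s (x y : M), ac s (x + y) = ac s x + ac s y := h6
  have e7 : ∀ r s (x : M), ac (r + s) x = ac r x + ac s x := h7
  let m : Module Sᵐᵒᵖ M :=
    { smul := fun s x => ac s.unop x
      one_smul := h5
      mul_smul := fun r s x => h8 s.unop r.unop x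
      smul_add := fun s x y => e6 s.unop x y
      smul_zero := fun s => by
        have := e6 s.unop 0 0
        rw [add_zero] at this
        exact left_eq_add.1 this
      add_smul := fun r s x => e7 r.unop s.unop x
      zero_smul := fun x => by
        have := e7 0 0 x
        rw [add_zero] at this
        exact left_eq_add.1 this }
  refine ⟨g, m, ?_⟩
  ext n f v
  · cases f with
    | zero => exact congrArg _ (Subsingleton.elim _ _)
    | neg =>
      exact congrArg (Structure.funMap (L := rightModuleLang S) RightModuleFunc.neg)
        (funext fun i => by rw [Subsingleton.elim i 0]; rfl)
    | add =>
      exact congrArg (Structure.funMap (L := rightModuleLang S) RightModuleFunc.add)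
        (funext fun i => by fin_cases i <;> rfl)
    | act s =>
      exact congrArg (Structure.funMap (L := rightModuleLang S) (RightModuleFunc.act s))
        (funext fun i => by rw [Subsingleton.elim i 0]; rfl)
  · exact nomatch f

end Structure

section Elementary

variable {S : Type u} [Ring S]

/-- Elementary embeddings of right modules are linear. -/
def linearMapOfElementary {M : Type v} {N : Type w} [AddCommGroup M] [AddCommGroup N]
    [Module Sᵐᵒᵖ M] [Module Sᵐᵒᵖ N] (j : M ↪ₑ[rightModuleLang S] N) : M →ₗ[Sᵐᵒᵖ] N where
  toFun := j
  map_add' x y := by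
    have h := j.map_fun (RightModuleFunc.add : (rightModuleLang S).Functions 2) ![x, y]
    exact h
  map_smul' s x := by
    have h := j.map_fun (RightModuleFunc.act s.unop : (rightModuleLang S).Functions 1) ![x]
    exact h

/-- An elementary extension of a right module, with a given solution and forbidden values, is itself
a right module. -/
theorem exists_module_of_structure (N : Type v) [AddCommGroup N] [Module Sᵐᵒᵖ N] {q : S} {c : N}
    (E : Set (S × N)) {N' : Type w} [inst : (rightModuleLang S).Structure N']
    (j : N ↪ₑ[rightModuleLang S] N') (h : N' ⊨ moduleTheory S) (b : N')
    (hq : Structure.funMap (L := rightModuleLang S) (RightModuleFunc.act q) ![b] = j c)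
    (hE : ∀ e ∈ E,
      Structure.funMap (L := rightModuleLang S) (RightModuleFunc.act e.1) ![b] ≠ j e.2) :
    ∃ (N' : Type w) (_ : AddCommGroup N') (_ : Module Sᵐᵒᵖ N')
      (j : N ↪ₑ[rightModuleLang S] N') (b : N'), MulOpposite.op q • b = j c ∧
        ∀ e ∈ E, MulOpposite.op e.1 • b ≠ j e.2 := by
  obtain ⟨g, m, rfl⟩ := exists_eq_toStructure N' h
  exact ⟨N', g, m, j, b, hq, hE⟩

/-- The ultrapower along finite subsets of a set `E` of forbidden values of multiples: it
contains a solution of `x.q = c` such that `x.r ≠ n` for all `(r, n) ∈ E`, provided that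
solutions for the finite subsets of `E` exist in the given module. -/
theorem exists_elementary_avoiding (N : Type u) [AddCommGroup N] [Module Sᵐᵒᵖ N] (q : S) (c : N)
    (E : Set (S × N))
    (h : ∀ F : Finset (S × N), ↑F ⊆ E → ∃ x : N, MulOpposite.op q • x = c ∧
      ∀ e ∈ F, MulOpposite.op e.1 • x ≠ e.2) :
    ∃ (N' : Type u) (_ : AddCommGroup N') (_ : Module Sᵐᵒᵖ N')
      (j : N ↪ₑ[rightModuleLang S] N') (b : N'), MulOpposite.op q • b = j c ∧
        ∀ e ∈ E, MulOpposite.op e.1 • b ≠ j e.2 := by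
  classical
  let U : Ultrafilter (Finset E) := Ultrafilter.of Filter.atTop
  -- Since the ultrafilter refines `atTop`, each single constraint is imposed on almost all
  -- coordinates.
  have hU : ∀ e : E, ∀ᶠ F in (U : Filter (Finset E)), e ∈ F := fun e =>
    Ultrafilter.of_le Filter.atTop
      ((Filter.eventually_ge_atTop {e}).mono fun F hF => Finset.singleton_subset_iff.1 hF)
  let N' := (U : Filter (Finset E)).Product fun _ => N
  have hx : ∀ F : Finset E, ∃ x : N, MulOpposite.op q • x = c ∧
      ∀ e ∈ F, MulOpposite.op e.1.1 • x ≠ e.1.2 := fun F => by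
    obtain ⟨x, h1, h2⟩ := h (F.image Subtype.val) (by simp)
    exact ⟨x, h1, fun e he => h2 e.1 (Finset.mem_image_of_mem _ he)⟩
  choose x hx1 hx2 using hx
  let i : N → N' := fun y => ((fun _ => y : Finset E → N) : N')
  let b : N' := (x : N')
  have hi : ∀ ⦃n : ℕ⦄ (ψ : (rightModuleLang S).Formula (Fin n)) (v : Fin n → N),
      ψ.Realize (i ∘ v) ↔ ψ.Realize v := fun n ψ v => by
    refine (Ultraproduct.realize_formula_cast (u := U) ψ (fun k _ => v k)).trans ?_
    exact Filter.eventually_const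
  have key : ∀ (r : S) (n : N), (Structure.funMap (L := rightModuleLang S) (RightModuleFunc.act r)
      ![b] = i n) ↔ ∀ᶠ F in (U : Filter (Finset E)), MulOpposite.op r • x F = n := fun r n => by
    have h1 : ![b] = fun k : Fin 1 => (((![x] : Fin 1 → Finset E → N) k : N')) :=
      funext fun k => by rw [Subsingleton.elim k 0]; rfl
    have h2 := Ultraproduct.funMap_cast (u := U) (L := rightModuleLang S) (M := fun _ => N)
      (RightModuleFunc.act r) ![x]
    exact (Eq.congr_left ((congrArg (Structure.funMap (L := rightModuleLang S)
      (RightModuleFunc.act r)) h1).trans h2)).trans Quotient.eq''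
  let j : N ↪ₑ[rightModuleLang S] N' := ⟨i, hi⟩
  have hmod : N' ⊨ moduleTheory S := by
    have : N ⊨ moduleTheory S := models_moduleTheory N
    exact (Theory.model_iff _).2 fun σ hσ =>
      (j.map_sentence σ).1 (Theory.realize_sentence_of_mem _ hσ)
  have hq := (key q c).2 (Filter.Eventually.of_forall hx1)
  have hE : ∀ e ∈ E, Structure.funMap (L := rightModuleLang S) (RightModuleFunc.act e.1)
      ![b] ≠ i e.2 := fun e he hb => by
    obtain ⟨F, h1, h2⟩ := (((key e.1 e.2).1 hb).and (hU ⟨e, he⟩)).exists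
    exact hx2 F ⟨e, he⟩ h2 h1
  exact exists_module_of_structure N E j hmod b hq hE

end Elementary

end RightModuleLang

/-! ### Partial isomorphisms and their one-point extensions -/

namespace RightModuleLang

attribute [local instance] toStructure

open MulOpposite

section PartialIso

variable {S : Type u} [Ring S] {M N : Type u} [AddCommGroup M] [AddCommGroup N]
  [Module Sᵐᵒᵖ M] [Module Sᵐᵒᵖ N]

/-- The graph of an isomorphism between a submodule of `M` and a submodule of `N`. -/
def IsPartialIso (G : Submodule Sᵐᵒᵖ (M × N)) : Prop := ∀ p ∈ G, p.1 = 0 ↔ p.2 = 0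

theorem isPartialIso_bot : IsPartialIso (⊥ : Submodule Sᵐᵒᵖ (M × N)) := by
  rintro p hp
  rw [(Submodule.mem_bot _).1 hp]
  simp

theorem IsPartialIso.swap {G : Submodule Sᵐᵒᵖ (M × N)} (h : IsPartialIso G) :
    IsPartialIso (G.comap (LinearEquiv.prodComm Sᵐᵒᵖ N M).toLinearMap) :=
  fun _ hp => (h _ hp).symm

theorem IsPartialIso.snd_unique {G : Submodule Sᵐᵒᵖ (M × N)} (h : IsPartialIso G) {a : M}
    {m n : N} (h1 : (a, m) ∈ G) (h2 : (a, n) ∈ G) : m = n := by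
  have := h _ (G.sub_mem h1 h2)
  exact sub_eq_zero.1 (this.1 (sub_self a))

theorem IsPartialIso.fst_unique {G : Submodule Sᵐᵒᵖ (M × N)} (h : IsPartialIso G) {a b : M}
    {m : N} (h1 : (a, m) ∈ G) (h2 : (b, m) ∈ G) : a = b := by
  have := h _ (G.sub_mem h1 h2)
  exact sub_eq_zero.1 (this.2 (sub_self m))

/-- An element of the sum is $(a+b.r,\,m+b'.r)$ with $(a,m)\in G$. Either the second summand is
already in $G$, or neither coordinate can vanish, since $b.r=-a$ would be in the domain and
$b'.r=-m$ in the range. -/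
theorem IsPartialIso.sup_span {G : Submodule Sᵐᵒᵖ (M × N)} (hG : IsPartialIso G) {b : M} {b' : N}
    (h : ∀ r : S, (op r • b, op r • b') ∈ G ∨
      (∀ m, (op r • b, m) ∉ G) ∧ ∀ a, (a, op r • b') ∉ G) :
    IsPartialIso (G ⊔ Submodule.span Sᵐᵒᵖ {(b, b')}) := by
  intro p hp
  obtain ⟨⟨a, m⟩, ham, z, hz, rfl⟩ := Submodule.mem_sup.1 hp
  obtain ⟨⟨r⟩, rfl⟩ := Submodule.mem_span_singleton.1 hz
  rcases h r with h | ⟨h1, h2⟩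
  · exact hG _ (G.add_mem ham h)
  · refine ⟨fun h0 => (h1 (-m) ?_).elim, fun h0 => (h2 (-a) ?_).elim⟩
    · have : op r • b = -a := eq_neg_of_add_eq_zero_right h0
      rw [this]
      exact G.neg_mem ham
    · have : op r • b' = -m := eq_neg_of_add_eq_zero_right h0
      rw [this]
      exact G.neg_mem ham

/-- After passing to an elementary extension of `N`, the partial isomorphism `G` extends to a
partial isomorphism with `b` in its domain. -/
def ExtendsTo (G : Submodule Sᵐᵒᵖ (M × N)) (b : M) : Prop :=
  ∃ (N' : Type u) (_ : AddCommGroup N') (_ : Module Sᵐᵒᵖ N') (j : N ↪ₑ[rightModuleLang S] N')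
    (G' : Submodule Sᵐᵒᵖ (M × N')), IsPartialIso G' ∧ (∀ p ∈ G, (p.1, j p.2) ∈ G') ∧
      ∃ b', (b, b') ∈ G'

theorem IsPartialIso.extendsTo_of_mem {G : Submodule Sᵐᵒᵖ (M × N)} (hG : IsPartialIso G) {b : M}
    {b' : N} (h : (b, b') ∈ G) : ExtendsTo G b :=
  ⟨N, _, _, ElementaryEmbedding.refl _ N, G, hG, fun _ hp => hp, b', h⟩

theorem IsPartialIso.extendsTo_of_sup_span {G : Submodule Sᵐᵒᵖ (M × N)} {b : M} {b' : N}
    (h : IsPartialIso (G ⊔ Submodule.span Sᵐᵒᵖ {(b, b')})) : ExtendsTo G b :=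
  ⟨N, _, _, ElementaryEmbedding.refl _ N, _, h, fun _ hp => Submodule.mem_sup_left hp, b',
    Submodule.mem_sup_right (Submodule.mem_span_singleton_self _)⟩

/-- The image of a graph under an elementary embedding. -/
def mapGraph {N' : Type u} [AddCommGroup N'] [Module Sᵐᵒᵖ N'] (G : Submodule Sᵐᵒᵖ (M × N))
    (j : N ↪ₑ[rightModuleLang S] N') : Submodule Sᵐᵒᵖ (M × N') :=
  G.map (LinearMap.prodMap LinearMap.id (linearMapOfElementary j))

theorem mem_mapGraph {N' : Type u} [AddCommGroup N'] [Module Sᵐᵒᵖ N']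
    {G : Submodule Sᵐᵒᵖ (M × N)} {j : N ↪ₑ[rightModuleLang S] N'} {a : M} {m : N'} :
    (a, m) ∈ mapGraph G j ↔ ∃ n, (a, n) ∈ G ∧ j n = m := by
  constructor
  · rintro ⟨⟨a', n⟩, h, he⟩
    obtain ⟨rfl, h2⟩ := Prod.ext_iff.1 he
    exact ⟨n, h, h2⟩
  · rintro ⟨n, h, rfl⟩
    exact ⟨(a, n), h, rfl⟩

theorem IsPartialIso.mapGraph {N' : Type u} [AddCommGroup N'] [Module Sᵐᵒᵖ N']
    {G : Submodule Sᵐᵒᵖ (M × N)} (hG : IsPartialIso G) (j : N ↪ₑ[rightModuleLang S] N') :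
    IsPartialIso (mapGraph G j) := by
  rintro ⟨a, m⟩ h
  obtain ⟨n, hn, rfl⟩ := mem_mapGraph.1 h
  refine (hG _ hn).trans ?_
  have h0 : j 0 = 0 := (linearMapOfElementary j).map_zero
  exact ⟨fun h => by rw [show n = 0 from h]; exact h0, fun h => j.injective (h.trans h0.symm)⟩

theorem ExtendsTo.of_mapGraph {N' : Type u} [AddCommGroup N'] [Module Sᵐᵒᵖ N']
    {G : Submodule Sᵐᵒᵖ (M × N)} (j : N ↪ₑ[rightModuleLang S] N') {b : M}
    (h : ExtendsTo (RightModuleLang.mapGraph G j) b) : ExtendsTo G b := by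
  obtain ⟨N'', g, m, i, G', h1, h2, h3⟩ := h
  exact ⟨N'', g, m, i.comp j, G', h1,
    fun p hp => h2 _ (mem_mapGraph.2 ⟨p.2, hp, rfl⟩ : (p.1, j p.2) ∈ _), h3⟩

end PartialIso

/-- Nonzero divisible right modules. -/
structure IsNonzeroDivisible (S : Type u) [Ring S] (M : Type v) [AddCommGroup M]
    [Module Sᵐᵒᵖ M] : Prop where
  nontrivial : Nontrivial M
  exists_smul_eq : ∀ r : S, r ≠ 0 → ∀ x : M, ∃ y : M, op r • y = x

/-- The cardinality of `ann_M(q)`, as an extended natural number. -/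
noncomputable def annCard {S : Type u} [Ring S] (q : S) (M : Type v) [AddCommGroup M]
    [Module Sᵐᵒᵖ M] : ℕ∞ := ENat.card {x : M // op q • x = 0}

section Transfer

variable {S : Type u} [Ring S] {M : Type v} {N : Type w} [AddCommGroup M] [AddCommGroup N]
  [Module Sᵐᵒᵖ M] [Module Sᵐᵒᵖ N]

theorem models_nonzeroDivisibleTheory :
    M ⊨ nonzeroDivisibleTheory S ↔ IsNonzeroDivisible S M :=
  (models_nonzeroDivisibleTheory_iff M).trans ⟨fun h => ⟨h.1, h.2⟩, fun h => ⟨h.1, h.2⟩⟩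

theorem annCard_eq_of_forall_annGe {q : S} (h : ∀ n, M ⊨ annGe q n ↔ N ⊨ annGe q n) :
    annCard q M = annCard q N := by
  refine ENat.eq_of_forall_natCast_le_iff fun n => ?_
  exact (realize_annGe M q n).symm.trans ((h n).trans (realize_annGe N q n))

theorem annCard_eq_of_elementary (j : M ↪ₑ[rightModuleLang S] N) (q : S) :
    annCard q M = annCard q N :=
  annCard_eq_of_forall_annGe fun _ => j.map_sentence _

theorem IsNonzeroDivisible.of_elementary (h : IsNonzeroDivisible S M)
    (j : M ↪ₑ[rightModuleLang S] N) : IsNonzeroDivisible S N := by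
  have hM := models_nonzeroDivisibleTheory.2 h
  exact models_nonzeroDivisibleTheory.1 ((Theory.model_iff _).2 fun σ hσ =>
    (j.map_sentence σ).1 (Theory.realize_sentence_of_mem _ hσ))

end Transfer

theorem smul_smul_add_smul_smul {S : Type u} [Ring S] {M : Type v} [AddCommGroup M]
    [Module Sᵐᵒᵖ M] {q r x y : S} (h : r * x + q * y = 1) (b : M) :
    op x • op r • b + op y • op q • b = b := by
  rw [← mul_smul, ← mul_smul, ← add_smul, ← op_mul, ← op_mul, ← op_add, h, op_one, one_smul]

/-! ### The extension step for divisible modules -/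

section Extension

variable {K : Type u} [Field K] {φ : K →+* K}

/-- On a finite module two powers $t^i\ne t^j$ would act alike, so the nonzero element $t^i-t^j$
would act as zero, against divisibility. -/
theorem IsNonzeroDivisible.infinite {N : Type v} [AddCommGroup N] [Module (TwistedPoly φ)ᵐᵒᵖ N]
    (h : IsNonzeroDivisible (TwistedPoly φ) N) : Infinite N := by
  by_contra hf
  rw [not_infinite_iff_finite] at hf
  obtain ⟨i, j, hij, he⟩ := Finite.exists_ne_map_eq_of_infinite
    (fun (i : ℕ) (x : N) => op (TwistedPoly.monomial φ i 1) • x)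
  have hne : TwistedPoly.monomial φ i 1 - TwistedPoly.monomial φ j 1 ≠ 0 := fun h0 => hij <| by
    rw [← TwistedPoly.natDegree_monomial (φ := φ) (i := i) one_ne_zero, sub_eq_zero.1 h0,
      TwistedPoly.natDegree_monomial one_ne_zero]
  obtain ⟨x, hx⟩ := (nontrivial_iff_exists_ne (0 : N)).1 h.nontrivial
  obtain ⟨y, hy⟩ := h.exists_smul_eq _ hne x
  rw [op_sub, sub_smul] at hy
  exact hx (hy.symm.trans (sub_eq_zero.2 (congrFun he y)))

variable {M N : Type u} [AddCommGroup M] [AddCommGroup N] [Module (TwistedPoly φ)ᵐᵒᵖ M]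
  [Module (TwistedPoly φ)ᵐᵒᵖ N]

/-- The free case: the image $b'$ is chosen in an ultrapower so that no nonzero multiple of it lies
in $N$, hence none lies in the range. -/
theorem extendsTo_of_forall_notMem (hN : IsNonzeroDivisible (TwistedPoly φ) N)
    {G : Submodule (TwistedPoly φ)ᵐᵒᵖ (M × N)} (hG : IsPartialIso G) (b : M)
    (hb : ∀ r : TwistedPoly φ, r ≠ 0 → ∀ n, (op r • b, n) ∉ G) : ExtendsTo G b := by
  have := hN.infinite
  -- The equation $x.0=0$ imposes nothing. For finitely many constraints $x.r_i\ne n_i$, take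
  -- $m=r_is_i$ for all $i$: if $x.m$ avoids the finitely many $n_i.s_i$, which is possible as $N$
  -- is infinite and divisible, then $x$ meets them all.
  obtain ⟨N', g, m, j, b', -, hb'⟩ := exists_elementary_avoiding N (0 : TwistedPoly φ) 0
    {e | e.1 ≠ 0} fun F hF => by
      classical
      obtain ⟨m, hm, hs⟩ := TwistedPoly.exists_common_multiple F Prod.fst fun e he => hF he
      choose! s hs using hs
      obtain ⟨y, hy⟩ := Infinite.exists_notMem_finset (F.image fun e => op (s e) • e.2)
      obtain ⟨x, hx⟩ := hN.exists_smul_eq m hm y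
      refine ⟨x, by simp, fun e he h => hy (Finset.mem_image.2 ⟨e, he, ?_⟩)⟩
      rw [← h, ← mul_smul, ← op_mul, hs e he, hx]
  refine ExtendsTo.of_mapGraph j (IsPartialIso.extendsTo_of_sup_span (b' := b')
    ((hG.mapGraph j).sup_span fun r => ?_))
  by_cases hr : r = 0
  · left
    simp [hr]
    exact (RightModuleLang.mapGraph G j).zero_mem
  · refine Or.inr ⟨fun m h => ?_, fun a h => ?_⟩
    · obtain ⟨n, hn, -⟩ := mem_mapGraph.1 h
      exact hb r hr n hn
    · obtain ⟨n, -, hn⟩ := mem_mapGraph.1 h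
      exact hb' (r, n) hr hn.symm

/-- Multiples by $r\in qR$ are in $G$ because $(b.q,b'.q)$ is. For $r\notin qR$, a relation
$rx+qy=1$ recovers $b$ from $b.r$ and $b.q$, so $b.r$ in the domain would force $b$ into it;
likewise for $b'$ and the range. -/
theorem IsPartialIso.sup_span_of_irreducible {G : Submodule (TwistedPoly φ)ᵐᵒᵖ (M × N)}
    (hG : IsPartialIso G) {b : M} {b' : N} {q : TwistedPoly φ} (hq : Irreducible q)
    (h : (op q • b, op q • b') ∈ G) (hb : ∀ m, (b, m) ∉ G) (hb' : ∀ a, (a, b') ∉ G) :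
    IsPartialIso (G ⊔ Submodule.span _ {(b, b')}) := by
  refine hG.sup_span fun r => ?_
  by_cases hr : ∃ s, r = q * s
  · obtain ⟨s, rfl⟩ := hr
    left
    rw [op_mul, mul_smul, mul_smul]
    exact G.smul_mem (op s) h
  · push Not at hr
    right
    obtain ⟨x, y, hxy⟩ := TwistedPoly.exists_add_eq_one hq hr
    have e1 := smul_smul_add_smul_smul hxy b
    have e2 := smul_smul_add_smul_smul hxy b'
    refine ⟨fun m hm => ?_, fun a ha => ?_⟩
    · have := G.add_mem (G.smul_mem (op x) hm) (G.smul_mem (op y) h)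
      rw [Prod.smul_mk, Prod.smul_mk, Prod.mk_add_mk, e1] at this
      exact hb _ this
    · have := G.add_mem (G.smul_mem (op x) ha) (G.smul_mem (op y) h)
      rw [Prod.smul_mk, Prod.smul_mk, Prod.mk_add_mk, e2] at this
      exact hb' _ this

/-- The irreducible case, and the only place in the back-and-forth where equality of annihilator
sizes is used for more than being handed on. -/
theorem extendsTo_of_irreducible (hN : IsNonzeroDivisible (TwistedPoly φ) N)
    {q : TwistedPoly φ} (hq : Irreducible q) (hc : annCard q M = annCard q N)
    {G : Submodule (TwistedPoly φ)ᵐᵒᵖ (M × N)} (hG : IsPartialIso G) (b : M) {n : N}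
    (hbn : (op q • b, n) ∈ G) : ExtendsTo G b := by
  by_cases hb : ∃ m, (b, m) ∈ G
  · obtain ⟨m, hm⟩ := hb
    exact hG.extendsTo_of_mem hm
  push Not at hb
  by_cases hb' : ∃ b' : N, op q • b' = n ∧ ∀ a, (a, b') ∉ G
  · obtain ⟨b', rfl, h⟩ := hb'
    exact IsPartialIso.extendsTo_of_sup_span (hG.sup_span_of_irreducible hq hbn hb h)
  push Not at hb'
  obtain ⟨d, hd⟩ := hN.exists_smul_eq q hq.ne_zero n
  by_cases hf : Infinite {x : N // op q • x = 0}
  -- Forbidding $x.1=n'$ for every $n'\in N$ makes the solution new; the infinite coset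
  -- $d+\mathrm{ann}_N(q)$ satisfies finitely many such constraints.
  · obtain ⟨N', g, m, j, b', h1, h2⟩ := exists_elementary_avoiding N q n {e | e.1 = 1}
      fun F hF => by
        classical
        obtain ⟨⟨y, hy⟩, hyF⟩ := Infinite.exists_notMem_finset
          ((F.image fun e => e.2 - d).subtype fun x => op q • x = 0)
        refine ⟨y + d, by rw [smul_add, hy, hd, zero_add], fun e he h => hyF ?_⟩
        have he1 : e.1 = 1 := hF he
        rw [he1, op_one, one_smul] at h
        rw [Finset.mem_subtype]
        exact Finset.mem_image.2 ⟨e, he, by rw [← h, add_sub_cancel_right]⟩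
    refine ExtendsTo.of_mapGraph j (IsPartialIso.extendsTo_of_sup_span (b' := b')
      ((hG.mapGraph j).sup_span_of_irreducible hq ?_ ?_ ?_))
    · exact mem_mapGraph.2 ⟨n, hbn, h1.symm⟩
    · intro m h
      obtain ⟨n, hn, -⟩ := mem_mapGraph.1 h
      exact hb n hn
    · intro a h
      obtain ⟨n, -, hn⟩ := mem_mapGraph.1 h
      refine h2 (1, n) rfl ?_
      rw [op_one, one_smul]
      exact hn.symm
  · exfalso
    rw [not_infinite_iff_finite] at hf
    obtain ⟨d', hd'⟩ := hb' d hd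
    have hM : Finite {x : M // op q • x = 0} := by
      rw [← ENat.card_lt_top]
      exact hc.trans_lt ENat.card_lt_top_of_finite
    have hcard : Nat.card {x : M // op q • x = 0} = Nat.card {x : N // op q • x = 0} := by
      have := hc
      rw [annCard, annCard, ENat.card_eq_coe_natCard, ENat.card_eq_coe_natCard] at this
      exact_mod_cast this
    have hbd : op q • b = op q • d' := hG.fst_unique hbn (by
      have := G.smul_mem (op q) hd'
      rwa [Prod.smul_mk, hd] at this)
    -- All solutions $d+z$ are in the range, so $G$ pulls $\mathrm{ann}_N(q)$ back injectively into
    -- $\mathrm{ann}_M(q)$. Equal finite sizes make this onto; hence $b-d'$, and with it $b$, lies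
    -- in the domain.
    have hz : ∀ z : {x : N // op q • x = 0}, ∃ a : {x : M // op q • x = 0}, (a.1, z.1) ∈ G := by
      rintro ⟨z, hz⟩
      obtain ⟨e, he⟩ := hb' (d + z) (by rw [smul_add, hd, hz, add_zero])
      have := G.sub_mem he hd'
      rw [Prod.mk_sub_mk, add_sub_cancel_left] at this
      refine ⟨⟨e - d', (hG _ (G.smul_mem (op q) this)).2 hz⟩, this⟩
    choose f hf using hz
    have hinj : Function.Injective f := fun z z' h => Subtype.ext (hG.snd_unique (hf z) (by
      rw [h]
      exact hf z'))
    have hbij := (Nat.bijective_iff_injective_and_card f).2 ⟨hinj, hcard.symm⟩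
    obtain ⟨z, hz⟩ := hbij.2 ⟨b - d', by rw [smul_sub, hbd, sub_self]⟩
    have := G.add_mem (hf z) hd'
    rw [hz, Prod.mk_add_mk, sub_add_cancel] at this
    exact hb _ this

/-- Since $b.(rs)=(b.r).s$, a factorization is handled by first adding $b.r$ and then $b$. The first
step changes the module, so $N$ and $G$ are quantified inside the induction. -/
theorem extendsTo_of_smul_mem {q : TwistedPoly φ} (hq : q ≠ 0) :
    ∀ (N : Type u) [AddCommGroup N] [Module (TwistedPoly φ)ᵐᵒᵖ N]
      (_ : IsNonzeroDivisible (TwistedPoly φ) N)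
      (_ : ∀ q : TwistedPoly φ, Irreducible q → annCard q M = annCard q N)
      (G : Submodule (TwistedPoly φ)ᵐᵒᵖ (M × N)) (_ : IsPartialIso G) (b : M) (n : N)
      (_ : (op q • b, n) ∈ G), ExtendsTo G b := by
  refine TwistedPoly.induction_on_irreducible (motive := fun q => ∀ (N : Type u) [AddCommGroup N]
    [Module (TwistedPoly φ)ᵐᵒᵖ N] (_ : IsNonzeroDivisible (TwistedPoly φ) N)
    (_ : ∀ q : TwistedPoly φ, Irreducible q → annCard q M = annCard q N)
    (G : Submodule (TwistedPoly φ)ᵐᵒᵖ (M × N)) (_ : IsPartialIso G) (b : M) (n : N)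
    (_ : (op q • b, n) ∈ G), ExtendsTo G b) ?_ ?_ ?_ q hq
  · rintro _ ⟨r, rfl⟩ N _ _ hN hc G hG b n hbn
    refine hG.extendsTo_of_mem (b' := op (↑r⁻¹ : TwistedPoly φ) • n) ?_
    have := G.smul_mem (op (↑r⁻¹ : TwistedPoly φ)) hbn
    rwa [Prod.smul_mk, ← mul_smul, ← op_mul, Units.mul_inv, op_one, one_smul] at this
  · intro r hr N _ _ hN hc G hG b n hbn
    exact extendsTo_of_irreducible hN hr (hc r hr) hG b hbn
  · intro r s hr hs ihr ihs N _ _ hN hc G hG b n hbn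
    rw [op_mul, mul_smul] at hbn
    obtain ⟨N', g, m, j, G', h1, h2, c', hc'⟩ := ihs N hN hc G hG _ n hbn
    obtain ⟨N'', g', m', j', G'', h1', h2', h3'⟩ := ihr N' (hN.of_elementary j)
      (fun q hq => (hc q hq).trans (annCard_eq_of_elementary j q)) G' h1 b c' hc'
    exact ⟨N'', g', m', j'.comp j, G'', h1', fun p hp => h2' _ (h2 _ hp), h3'⟩

theorem IsPartialIso.extendsTo (hN : IsNonzeroDivisible (TwistedPoly φ) N)
    (hc : ∀ q : TwistedPoly φ, Irreducible q → annCard q M = annCard q N)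
    {G : Submodule (TwistedPoly φ)ᵐᵒᵖ (M × N)} (hG : IsPartialIso G) (b : M) : ExtendsTo G b := by
  by_cases h : ∀ r : TwistedPoly φ, r ≠ 0 → ∀ n, (op r • b, n) ∉ G
  · exact extendsTo_of_forall_notMem hN hG b h
  · push Not at h
    obtain ⟨r, hr, n, hn⟩ := h
    exact extendsTo_of_smul_mem hr N hN hc G hG b n hn

end Extension

/-! ### Preservation of formulas under partial isomorphisms -/

section Preservation

theorem realize_term_mem {S : Type u} [Ring S] {M N : Type u} [AddCommGroup M] [AddCommGroup N]
    [Module Sᵐᵒᵖ M] [Module Sᵐᵒᵖ N] (G : Submodule Sᵐᵒᵖ (M × N)) {α : Type v} {v : α → M}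
    {w : α → N} (h : ∀ i, (v i, w i) ∈ G) (t : (rightModuleLang S).Term α) :
    (t.realize v, t.realize w) ∈ G := by
  induction t with
  | var i => exact h i
  | func f ts ih =>
    cases f with
    | zero => exact G.zero_mem
    | neg => exact G.neg_mem (ih 0)
    | add => exact G.add_mem (ih 0) (ih 1)
    | act s => exact G.smul_mem (op s) (ih 0)

variable {K : Type u} [Field K] {φ : K →+* K}

/-- The formula is preserved by partial isomorphisms between nonzero divisible modules with the same
annihilator cardinalities. -/
def IsPreserved {α : Type v} {n : ℕ}
    (ψ : (rightModuleLang (TwistedPoly φ)).BoundedFormula α n) : Prop :=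
  ∀ (M N : Type u) [AddCommGroup M] [AddCommGroup N] [Module (TwistedPoly φ)ᵐᵒᵖ M]
    [Module (TwistedPoly φ)ᵐᵒᵖ N] (_ : IsNonzeroDivisible (TwistedPoly φ) M)
    (_ : IsNonzeroDivisible (TwistedPoly φ) N)
    (_ : ∀ q : TwistedPoly φ, Irreducible q → annCard q M = annCard q N)
    (G : Submodule (TwistedPoly φ)ᵐᵒᵖ (M × N)) (_ : IsPartialIso G) (v : α → M) (w : α → N)
    (xs : Fin n → M) (ys : Fin n → N) (_ : ∀ i, (v i, w i) ∈ G) (_ : ∀ i, (xs i, ys i) ∈ G),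
    ψ.Realize v xs ↔ ψ.Realize w ys

/-- A witness $b\in M$ acquires an image in an elementary extension of $N$, where the universal
formula still holds. Enlarging only the second module is enough, as the converse follows by swapping
the graph. -/
theorem IsPreserved.realize_all {α : Type v} {n : ℕ}
    {ψ : (rightModuleLang (TwistedPoly φ)).BoundedFormula α (n + 1)} (hψ : IsPreserved ψ)
    {M N : Type u} [AddCommGroup M] [AddCommGroup N] [Module (TwistedPoly φ)ᵐᵒᵖ M]
    [Module (TwistedPoly φ)ᵐᵒᵖ N] (hM : IsNonzeroDivisible (TwistedPoly φ) M)
    (hN : IsNonzeroDivisible (TwistedPoly φ) N)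
    (hc : ∀ q : TwistedPoly φ, Irreducible q → annCard q M = annCard q N)
    {G : Submodule (TwistedPoly φ)ᵐᵒᵖ (M × N)} (hG : IsPartialIso G) {v : α → M} {w : α → N}
    {xs : Fin n → M} {ys : Fin n → N} (hv : ∀ i, (v i, w i) ∈ G) (hx : ∀ i, (xs i, ys i) ∈ G)
    (h : ψ.all.Realize w ys) : ψ.all.Realize v xs := by
  intro b
  obtain ⟨N', g, m, j, G', h1, h2, b', hb'⟩ := hG.extendsTo hN hc b
  have h3 := (j.map_boundedFormula ψ.all w ys).2 h
  refine (hψ M N' hM (hN.of_elementary j)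
    (fun q hq => (hc q hq).trans (annCard_eq_of_elementary j q)) G' h1 v (j ∘ w) _
    (Fin.snoc (j ∘ ys) b') (fun i => h2 _ (hv i)) fun i => ?_).2 (h3 b')
  refine Fin.lastCases ?_ (fun i => ?_) i
  · simpa using hb'
  · simpa using h2 _ (hx i)

theorem isPreserved {α : Type v} {n : ℕ}
    (ψ : (rightModuleLang (TwistedPoly φ)).BoundedFormula α n) : IsPreserved ψ := by
  induction ψ with
  | falsum => exact fun M N _ _ _ _ _ _ _ _ _ _ _ _ _ _ _ => Iff.rfl
  | @equal n t₁ t₂ =>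
    intro M N _ _ _ _ hM hN hc G hG v w xs ys hv hx
    have hvx : ∀ i, (Sum.elim v xs i, Sum.elim w ys i) ∈ G := fun i => by
      cases i with
      | inl i => exact hv i
      | inr i => exact hx i
    have h := hG _ (G.sub_mem (realize_term_mem G hvx t₁) (realize_term_mem G hvx t₂))
    exact sub_eq_zero.symm.trans (h.trans sub_eq_zero)
  | rel R => exact nomatch R
  | imp _ _ ih₁ ih₂ =>
    intro M N _ _ _ _ hM hN hc G hG v w xs ys hv hx
    exact imp_congr (ih₁ M N hM hN hc G hG v w xs ys hv hx)
      (ih₂ M N hM hN hc G hG v w xs ys hv hx)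
  | all ψ ih =>
    intro M N _ _ _ _ hM hN hc G hG v w xs ys hv hx
    exact ⟨ih.realize_all hN hM (fun q hq => (hc q hq).symm) hG.swap hv hx,
      ih.realize_all hM hN hc hG hv hx⟩

/-- Nonzero divisible modules with the same annihilator cardinalities are elementarily equivalent. -/
theorem realize_sentence_iff {M N : Type u} [AddCommGroup M] [AddCommGroup N]
    [Module (TwistedPoly φ)ᵐᵒᵖ M] [Module (TwistedPoly φ)ᵐᵒᵖ N]
    (hM : IsNonzeroDivisible (TwistedPoly φ) M) (hN : IsNonzeroDivisible (TwistedPoly φ) N)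
    (hc : ∀ q : TwistedPoly φ, Irreducible q → annCard q M = annCard q N)
    (σ : (rightModuleLang (TwistedPoly φ)).Sentence) : M ⊨ σ ↔ N ⊨ σ :=
  isPreserved σ M N hM hN hc ⊥ isPartialIso_bot _ _ _ _ (fun i => i.elim) (fun i => i.elim0)

/-- Tuples with the same quantifier-free type, in nonzero divisible modules with the same annihilator
cardinalities, have the same type. -/
theorem realize_formula_iff {M N : Type u} [AddCommGroup M] [AddCommGroup N]
    [Module (TwistedPoly φ)ᵐᵒᵖ M] [Module (TwistedPoly φ)ᵐᵒᵖ N]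
    (hM : IsNonzeroDivisible (TwistedPoly φ) M) (hN : IsNonzeroDivisible (TwistedPoly φ) N)
    (hc : ∀ q : TwistedPoly φ, Irreducible q → annCard q M = annCard q N) {n : ℕ}
    {v : Fin n → M} {w : Fin n → N}
    (h : ∀ χ : (rightModuleLang (TwistedPoly φ)).Formula (Fin n), χ.IsQF →
      (χ.Realize v ↔ χ.Realize w))
    (ψ : (rightModuleLang (TwistedPoly φ)).Formula (Fin n)) : ψ.Realize v ↔ ψ.Realize w := by
  -- The graph of the map between the submodules generated by $v$ and $w$; equality of the atomic
  -- formulas $t=0$ makes it a partial isomorphism.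
  let G : Submodule (TwistedPoly φ)ᵐᵒᵖ (M × N) :=
    { carrier := {p | ∃ t : (rightModuleLang (TwistedPoly φ)).Term (Fin n),
        p = (t.realize v, t.realize w)}
      add_mem' := by
        rintro _ _ ⟨t, rfl⟩ ⟨t', rfl⟩
        exact ⟨addTerm t t', rfl⟩
      zero_mem' := ⟨zeroTerm, rfl⟩
      smul_mem' := by
        rintro s _ ⟨t, rfl⟩
        exact ⟨actTerm t s.unop, rfl⟩ }
  have hG : IsPartialIso G := by
    rintro _ ⟨t, rfl⟩
    have h1 := h (Term.equal t zeroTerm) (BoundedFormula.IsAtomic.equal _ _).isQF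
    rw [Formula.realize_equal, Formula.realize_equal] at h1
    exact h1
  exact isPreserved ψ M N hM hN hc G hG v w _ _ (fun i => ⟨Term.var i, rfl⟩) (fun i => i.elim0)

end Preservation

end RightModuleLang

/-! ### Possible sizes of annihilators -/

/-- The cardinality of a vector space, as an extended natural number. -/
theorem ENat.card_vectorSpace (D : Type u) (V : Type v) [DivisionRing D] [AddCommGroup V]
    [Module D V] : ENat.card V = ⊤ ∨ ∃ n : ℕ, ENat.card V = ENat.card D ^ n := by
  by_cases h : Infinite V
  · exact Or.inl ENat.card_eq_top_of_infinite
  · rw [not_infinite_iff_finite] at h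
    refine Or.inr ⟨Module.finrank D V, ?_⟩
    rw [ENat.card_congr (Module.finBasis D V).equivFun.toEquiv, ENat.card_fun]
    simp

namespace RightModuleLang

open MulOpposite TwistedPoly

section FixedField

variable {K : Type u} [Field K] {φ : K →+* K}

theorem monomial_zero_mul_comm {a : K} (h : φ a = a) (q : TwistedPoly φ) :
    monomial φ 0 a * q = q * monomial φ 0 a := by
  ext i
  rw [coeff_mul, coeff_mul, Finset.sum_eq_single (0, i), Finset.sum_eq_single (i, 0)]
  · simp [coeff_monomial, Function.iterate_fixed h, mul_comm]
  · rintro ⟨k, l⟩ hkl hne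
    rw [Finset.HasAntidiagonal.mem_antidiagonal] at hkl
    have : (0 : ℕ) ≠ l := by
      rintro rfl
      exact hne (Prod.ext (by simpa using hkl) rfl)
    simp [coeff_monomial, this]
  · intro hn
    exact absurd (Finset.HasAntidiagonal.mem_antidiagonal.2 (by simp)) hn
  · rintro ⟨k, l⟩ hkl hne
    rw [Finset.HasAntidiagonal.mem_antidiagonal] at hkl
    have : (0 : ℕ) ≠ k := by
      rintro rfl
      exact hne (Prod.ext rfl (by simpa using hkl))
    simp [coeff_monomial, this, iterate_map_zero]
  · intro hn
    exact absurd (Finset.HasAntidiagonal.mem_antidiagonal.2 (by simp)) hn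

/-- The fixed field of `φ`. -/
abbrev fixedField (φ : K →+* K) : Subfield K := RingHom.eqLocusField φ (RingHom.id K)

/-- The fixed field acts centrally on right modules. -/
noncomputable def fixedFieldHom (φ : K →+* K) : fixedField φ →+* (TwistedPoly φ)ᵐᵒᵖ where
  toFun a := op (monomial φ 0 a)
  map_one' := rfl
  map_zero' := congrArg op (Finsupp.single_zero 0)
  map_add' a b := congrArg op (Finsupp.single_add 0 (a : K) b)
  map_mul' a b := by
    rw [← op_mul, monomial_mul_monomial, Function.iterate_zero, id, mul_comm (b : K)]
    rfl

/-- Constants fixed by $\varphi$ are central in $R$, so the annihilator is a $K_0$-subspace of $M$.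
-/
theorem annCard_mem_fixedFieldPowers (q : TwistedPoly φ) (M : Type v) [AddCommGroup M]
    [Module (TwistedPoly φ)ᵐᵒᵖ M] : annCard q M ∈ fixedFieldPowers φ := by
  let _ : Module (fixedField φ) M := Module.compHom M (fixedFieldHom φ)
  let A : Submodule (fixedField φ) M :=
    { carrier := {x | op q • x = 0}
      add_mem' := fun {x y} hx hy => by
        rw [Set.mem_ofPred_eq] at *
        rw [smul_add, hx, hy, add_zero]
      zero_mem' := smul_zero _
      smul_mem' := fun a x hx => by
        rw [Set.mem_ofPred_eq] at *
        change op q • op (monomial φ 0 (a : K)) • x = 0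
        rw [← mul_smul, ← op_mul, monomial_zero_mul_comm a.2, op_mul, mul_smul, hx, smul_zero] }
  rcases ENat.card_vectorSpace (fixedField φ) A with h | ⟨n, h⟩
  · exact Or.inr h
  · exact Or.inl ⟨n, h⟩

/-- For $q=apb$ with units $a,b$, the map $x\mapsto x.a$ is a bijection from $\mathrm{ann}(q)$ to
$\mathrm{ann}(p)$. -/
theorem annCard_eq_of_kConj {p q : TwistedPoly φ} (h : KConj p q) (M : Type v) [AddCommGroup M]
    [Module (TwistedPoly φ)ᵐᵒᵖ M] : annCard q M = annCard p M := by
  obtain ⟨a, b, ha, hb, rfl⟩ := h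
  obtain ⟨α, hα⟩ := isUnit_monomial_zero (φ := φ) ha
  obtain ⟨β, hβ⟩ := isUnit_monomial_zero (φ := φ) hb
  rw [← hα, ← hβ]
  have hβ0 : ∀ x : M, op (β : TwistedPoly φ) • x = 0 ↔ x = 0 := fun x =>
    ⟨fun h => by
      have := congrArg (fun y => op (↑β⁻¹ : TwistedPoly φ) • y) h
      simpa [← mul_smul, ← op_mul] using this, fun h => by rw [h, smul_zero]⟩
  refine ENat.card_congr
    { toFun := fun x => ⟨op (α : TwistedPoly φ) • x.1, ?_⟩
      invFun := fun x => ⟨op (↑α⁻¹ : TwistedPoly φ) • x.1, ?_⟩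
      left_inv := fun x => Subtype.ext ?_
      right_inv := fun x => Subtype.ext ?_ }
  · rw [← hβ0, ← mul_smul, ← mul_smul, ← op_mul, ← op_mul, ← mul_assoc]
    exact x.2
  · rw [← mul_smul, ← op_mul, ← mul_assoc, ← mul_assoc, Units.inv_mul, one_mul, op_mul, mul_smul,
      hβ0]
    exact x.2
  · simp [← mul_smul, ← op_mul]
  · simp [← mul_smul, ← op_mul]

end FixedField

section Cyclic

variable {K : Type u} [Field K] {φ : K →+* K}

theorem mem_span_singleton {q r : TwistedPoly φ} :
    r ∈ Submodule.span (TwistedPoly φ)ᵐᵒᵖ {q} ↔ ∃ s, r = q * s := by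
  rw [Submodule.mem_span_singleton]
  exact ⟨fun ⟨s, hs⟩ => ⟨s.unop, hs.symm⟩, fun ⟨s, hs⟩ => ⟨op s, hs.symm⟩⟩

theorem isSimpleModule_cyclicModule {q : TwistedPoly φ} (hq : Irreducible q) :
    IsSimpleModule (TwistedPoly φ)ᵐᵒᵖ (CyclicModule q) := by
  rw [isSimpleModule_iff_isCoatom]
  refine ⟨fun h => ?_, fun I hI => ?_⟩
  · have h1 : (1 : TwistedPoly φ) ∈ Submodule.span (TwistedPoly φ)ᵐᵒᵖ {q} := by
      rw [h]
      trivial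
    obtain ⟨s, hs⟩ := mem_span_singleton.1 h1
    exact hq.not_isUnit (IsUnit.of_mul_eq_one _ hs.symm)
  · obtain ⟨hle, r, hr, hrq⟩ := SetLike.lt_iff_le_and_exists.1 hI
    rw [mem_span_singleton] at hrq
    push Not at hrq
    obtain ⟨x, y, hxy⟩ := exists_add_eq_one hq hrq
    have hqI : q ∈ I := hle (Submodule.mem_span_singleton_self q)
    have h1 : (1 : TwistedPoly φ) ∈ I := by
      rw [← hxy]
      exact I.add_mem (I.smul_mem (op x) hr) (I.smul_mem (op y) hqI)
    rw [eq_top_iff]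
    intro s _
    have := I.smul_mem (op s) h1
    rwa [op_smul_eq_mul, one_mul] at this

variable {M : Type v} [AddCommGroup M] [Module (TwistedPoly φ)ᵐᵒᵖ M]

/-- The map `r ↦ x.r`. -/
noncomputable def actHom (x : M) : TwistedPoly φ →ₗ[(TwistedPoly φ)ᵐᵒᵖ] M where
  toFun r := op r • x
  map_add' r s := by rw [op_add, add_smul]
  map_smul' s r := by
    rw [RingHom.id_apply, ← mul_smul]
    rfl

/-- Homomorphisms from `R / qR` correspond to elements annihilated by `q`. -/
noncomputable def homEquivAnn (q : TwistedPoly φ) (M : Type v) [AddCommGroup M]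
    [Module (TwistedPoly φ)ᵐᵒᵖ M] :
    (CyclicModule q →ₗ[(TwistedPoly φ)ᵐᵒᵖ] M) ≃ {x : M // op q • x = 0} where
  toFun f := ⟨f (Submodule.Quotient.mk 1), by
    rw [← f.map_smul, ← Submodule.Quotient.mk_smul, op_smul_eq_mul, one_mul,
      (Submodule.Quotient.mk_eq_zero _).2 (Submodule.mem_span_singleton_self q), f.map_zero]⟩
  invFun x := Submodule.liftQ _ (actHom x.1) (by
    rw [Submodule.span_le, Set.singleton_subset_iff]
    exact x.2)
  left_inv f := by
    refine Submodule.linearMap_qext _ (LinearMap.ext fun r => ?_)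
    change op r • f (Submodule.Quotient.mk 1) = f (Submodule.Quotient.mk r)
    rw [← f.map_smul, ← Submodule.Quotient.mk_smul, op_smul_eq_mul, one_mul]
  right_inv x := Subtype.ext (by
    change op (1 : TwistedPoly φ) • x.1 = x.1
    rw [op_one, one_smul])

theorem annCard_eq_card_hom (q : TwistedPoly φ) (M : Type v) [AddCommGroup M]
    [Module (TwistedPoly φ)ᵐᵒᵖ M] :
    annCard q M = ENat.card (CyclicModule q →ₗ[(TwistedPoly φ)ᵐᵒᵖ] M) :=
  (ENat.card_congr (homEquivAnn q M)).symm

theorem annCard_eq_of_linearEquiv {p q : TwistedPoly φ}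
    (e : CyclicModule p ≃ₗ[(TwistedPoly φ)ᵐᵒᵖ] CyclicModule q) (M : Type v) [AddCommGroup M]
    [Module (TwistedPoly φ)ᵐᵒᵖ M] : annCard p M = annCard q M := by
  rw [annCard_eq_card_hom, annCard_eq_card_hom]
  exact ENat.card_congr
    { toFun := fun f => f.comp e.symm.toLinearMap
      invFun := fun f => f.comp e.toLinearMap
      left_inv := fun f => by ext; simp
      right_inv := fun f => by ext; simp }

end Cyclic

/-- The homomorphisms from a simple module form a vector space over its endomorphism ring. -/
theorem card_hom_simple (A : Type u) [Ring A] (S : Type v) (M : Type w) [AddCommGroup S]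
    [AddCommGroup M] [Module A S] [Module A M] [IsSimpleModule A S] :
    ENat.card (S →ₗ[A] M) = ⊤ ∨
      ∃ n : ℕ, ENat.card (S →ₗ[A] M) = ENat.card (Module.End A S) ^ n := by
  classical
  -- Endomorphisms act by precomposition, that is, from the right; by Schur's lemma they form a
  -- division ring.
  let _ : Module (Module.End A S)ᵐᵒᵖ (S →ₗ[A] M) :=
    { smul := fun d f => f.comp d.unop
      one_smul := fun f => rfl
      mul_smul := fun d e f => rfl
      smul_zero := fun d => rfl
      zero_smul := fun f => f.comp_zero
      smul_add := fun d f g => rfl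
      add_smul := fun d e f => LinearMap.ext fun _ => f.map_add _ _ }
  rw [ENat.card_congr (opEquiv : Module.End A S ≃ _)]
  exact ENat.card_vectorSpace _ _

section Simple

variable {K : Type u} [Field K] {φ : K →+* K}

theorem annCard_eq_top_or (q : TwistedPoly φ) (hq : Irreducible q) (M : Type v) [AddCommGroup M]
    [Module (TwistedPoly φ)ᵐᵒᵖ M] : annCard q M = ⊤ ∨
      ∃ n : ℕ, annCard q M = ENat.card (Module.End (TwistedPoly φ)ᵐᵒᵖ (CyclicModule q)) ^ n := by
  have := isSimpleModule_cyclicModule hq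
  rw [annCard_eq_card_hom]
  exact card_hom_simple _ _ _

/-- By Schur's lemma there are no nonzero maps between non-isomorphic simple modules. This keeps the
factors in the construction of `exists_annCard_eq` independent. -/
theorem annCard_cyclicModule_of_isEmpty {p q : TwistedPoly φ} (hp : Irreducible p)
    (hq : Irreducible q)
    (h : IsEmpty (CyclicModule p ≃ₗ[(TwistedPoly φ)ᵐᵒᵖ] CyclicModule q)) :
    Subsingleton {x : CyclicModule q // op p • x = 0} := by
  have := isSimpleModule_cyclicModule hp
  have := isSimpleModule_cyclicModule hq
  rw [← (homEquivAnn p (CyclicModule q)).subsingleton_congr]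
  refine subsingleton_of_forall_eq 0 fun f => ?_
  exact f.bijective_or_eq_zero.resolve_left fun hf => h.false (LinearEquiv.ofBijective f hf)

end Simple

/-! ### Divisible modules with prescribed annihilators -/

section Construction

variable {K : Type u} [Field K] {φ : K →+* K}

/-- Every module embeds into a divisible one. -/
theorem exists_divisible_extension (X : Type u) [AddCommGroup X] [Module (TwistedPoly φ)ᵐᵒᵖ X] :
    ∃ (I : Type u) (_ : AddCommGroup I) (_ : Module (TwistedPoly φ)ᵐᵒᵖ I)
      (i : X →ₗ[(TwistedPoly φ)ᵐᵒᵖ] I), Function.Injective i ∧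
        ∀ r : TwistedPoly φ, r ≠ 0 → ∀ x : I, ∃ y : I, op r • y = x := by
  let X' := ModuleCat.of (TwistedPoly φ)ᵐᵒᵖ X
  let I := CategoryTheory.Injective.under X'
  let i := CategoryTheory.Injective.ι X'
  have hI : Module.Injective (TwistedPoly φ)ᵐᵒᵖ I :=
    Module.injective_module_of_injective_object _ _
      (inj := inferInstanceAs (CategoryTheory.Injective (CategoryTheory.Injective.under X')))
  refine ⟨I, inferInstance, inferInstance, i.hom, (ModuleCat.mono_iff_injective i).1 inferInstance,
    fun r hr x => ?_⟩
  -- As $R$ is a domain, $s\mapsto rs$ is injective, so $s\mapsto x.s$ factors through it by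
  -- injectivity of $I$; then $h(1).r=h(r)=x$.
  obtain ⟨h, hh⟩ := hI.out (actHom r : TwistedPoly φ →ₗ[(TwistedPoly φ)ᵐᵒᵖ] TwistedPoly φ)
    (fun s t hst => mul_left_cancel₀ hr hst) (actHom x)
  refine ⟨h 1, ?_⟩
  calc op r • h 1 = h (op r • (1 : TwistedPoly φ)) := (h.map_smul _ _).symm
    _ = h (actHom r 1) := by
      congr 1
      change op r • (1 : TwistedPoly φ) = op (1 : TwistedPoly φ) • r
      simp
    _ = actHom x 1 := hh 1
    _ = op (1 : TwistedPoly φ) • x := rfl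
    _ = x := by rw [op_one, one_smul]

variable {I : Type v} [AddCommGroup I] [Module (TwistedPoly φ)ᵐᵒᵖ I]

/-- If a root $x$ of $x.q=y$ is not in $Y$, maximality gives a new $z\in Y+xR$ killed by an
irreducible. Then $zR$ is simple and meets $Y$ in $0$, and $x$ can be corrected by a multiple of $z$
to a root in $Y$. -/
theorem exists_smul_eq_of_maximal
    (hI : ∀ r : TwistedPoly φ, r ≠ 0 → ∀ x : I, ∃ y : I, op r • y = x)
    {X Y : Submodule (TwistedPoly φ)ᵐᵒᵖ I}
    (hY : Maximal (· ∈ {Y : Submodule (TwistedPoly φ)ᵐᵒᵖ I | X ≤ Y ∧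
      ∀ p : TwistedPoly φ, Irreducible p → ∀ y ∈ Y, op p • y = 0 → y ∈ X}) Y)
    {q : TwistedPoly φ} (hq : Irreducible q) {y : I} (hy : y ∈ Y) : ∃ x ∈ Y, op q • x = y := by
  obtain ⟨x, rfl⟩ := hI q hq.ne_zero y
  by_cases hx : x ∈ Y
  · exact ⟨x, hx, rfl⟩
  have hn : ¬ ∀ p : TwistedPoly φ, Irreducible p →
      ∀ y ∈ Y ⊔ Submodule.span _ {x}, op p • y = 0 → y ∈ X := fun h =>
    hx (hY.2 (y := Y ⊔ Submodule.span _ {x}) ⟨hY.1.1.trans le_sup_left, h⟩ le_sup_left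
      (Submodule.mem_sup_right (Submodule.mem_span_singleton_self x)))
  push Not at hn
  obtain ⟨p, hp, z, hz, hpz, hzX⟩ := hn
  have hzY : z ∉ Y := fun h => hzX (hY.1.2 p hp z h hpz)
  have hzr : ∀ r : TwistedPoly φ, op r • z ∈ Y → op r • z = 0 := by
    intro r hr
    by_cases hrp : ∃ s, r = p * s
    · obtain ⟨s, rfl⟩ := hrp
      rw [op_mul, mul_smul, hpz, smul_zero]
    · push Not at hrp
      obtain ⟨a, b, hab⟩ := exists_add_eq_one hp hrp
      refine (hzY ?_).elim
      have := smul_smul_add_smul_smul hab z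
      rw [hpz, smul_zero, add_zero] at this
      rw [← this]
      exact Y.smul_mem _ hr
  obtain ⟨y₀, hy₀, x', hx', hyz⟩ := Submodule.mem_sup.1 hz
  obtain ⟨s', rfl⟩ := Submodule.mem_span_singleton.1 hx'
  obtain ⟨s, rfl⟩ := op_surjective s'
  by_cases hs : ∃ s', s = q * s'
  · obtain ⟨s', rfl⟩ := hs
    refine (hzY ?_).elim
    rw [← hyz, op_mul, mul_smul]
    exact Y.add_mem hy₀ (Y.smul_mem _ hy)
  push Not at hs
  obtain ⟨a, b, hab⟩ := exists_add_eq_one hq hs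
  -- With $z=y_0+x.s$ and $sa+qb=1$, one has $x=x.sa+x.qb=z.a+(x.q).b-y_0.a$. Then $z.aq=x.q-t.q$
  -- lies in $Y\cap zR=0$, so $t.q=x.q$.
  obtain ⟨t, htY, hxt⟩ : ∃ t ∈ Y, op a • z + t = x := by
    refine ⟨op b • (op q • x) - op a • y₀, Y.sub_mem (Y.smul_mem _ hy) (Y.smul_mem _ hy₀), ?_⟩
    nth_rw 2 [← smul_smul_add_smul_smul hab x]
    rw [← hyz, smul_add]
    abel
  have hq' : op (a * q) • z + op q • t = op q • x := by
    rw [← hxt, smul_add, ← mul_smul, ← op_mul]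
  have h0 : op (a * q) • z = 0 := by
    refine hzr _ ?_
    rw [eq_sub_of_add_eq hq']
    exact Y.sub_mem hy (Y.smul_mem _ htY)
  refine ⟨t, htY, ?_⟩
  rw [← hq', h0, zero_add]

/-- Every module embeds into a divisible one without new elements annihilated by irreducible
elements. -/
theorem exists_divisible_extension_annCard (X : Type u) [AddCommGroup X]
    [Module (TwistedPoly φ)ᵐᵒᵖ X] [Nontrivial X] :
    ∃ (M : Type u) (_ : AddCommGroup M) (_ : Module (TwistedPoly φ)ᵐᵒᵖ M),
      IsNonzeroDivisible (TwistedPoly φ) M ∧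
        ∀ q : TwistedPoly φ, Irreducible q → annCard q M = annCard q X := by
  obtain ⟨I, _, _, i, hi, hI⟩ := exists_divisible_extension (φ := φ) X
  obtain ⟨Y, hXY, hY⟩ := zorn_le_nonempty₀ {Y : Submodule (TwistedPoly φ)ᵐᵒᵖ I |
      LinearMap.range i ≤ Y ∧ ∀ p : TwistedPoly φ, Irreducible p →
        ∀ y ∈ Y, op p • y = 0 → y ∈ LinearMap.range i} (by
    intro c hc hchain Z hZ
    refine ⟨sSup c, ⟨(hc hZ).1.trans (le_sSup hZ), fun p hp y hy h0 => ?_⟩, fun W hW => le_sSup hW⟩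
    obtain ⟨W, hW, hyW⟩ := (Submodule.mem_sSup_of_directed ⟨Z, hZ⟩ hchain.directedOn).1 hy
    exact (hc hW).2 p hp y hyW h0) (LinearMap.range i) ⟨le_rfl, fun _ _ _ h _ => h⟩
  have hdiv : ∀ r : TwistedPoly φ, r ≠ 0 → ∀ y ∈ Y, ∃ x ∈ Y, op r • x = y := by
    refine induction_on_irreducible ?_ ?_ ?_
    · rintro _ ⟨r, rfl⟩ y hy
      refine ⟨op (↑r⁻¹ : TwistedPoly φ) • y, Y.smul_mem _ hy, ?_⟩
      rw [← mul_smul, ← op_mul, Units.inv_mul, op_one, one_smul]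
    · intro r hr y hy
      exact exists_smul_eq_of_maximal hI hY hr hy
    · intro r s _ _ hr hs y hy
      obtain ⟨x, hx, rfl⟩ := hs y hy
      obtain ⟨w, hw, rfl⟩ := hr x hx
      exact ⟨w, hw, by rw [op_mul, mul_smul]⟩
  let e : X → Y := fun x => ⟨i x, hY.1.1 ⟨x, rfl⟩⟩
  have he : Function.Injective e := fun x y h => hi (congrArg Subtype.val h)
  refine ⟨Y, inferInstance, inferInstance, ⟨he.nontrivial, fun r hr y => ?_⟩, fun q hq => ?_⟩
  · obtain ⟨x, hx, h⟩ := hdiv r hr y.1 y.2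
    exact ⟨⟨x, hx⟩, Subtype.ext h⟩
  · refine (ENat.card_congr (Equiv.ofBijective
      (fun x : {x : X // op q • x = 0} => (⟨e x.1, Subtype.ext ?_⟩ : {y : Y // op q • y = 0}))
      ⟨fun x y h => Subtype.ext (he (congrArg Subtype.val h)), ?_⟩)).symm
    · change op q • i x.1 = 0
      rw [← i.map_smul, x.2, i.map_zero]
    · rintro ⟨⟨y, hyY⟩, hy⟩
      have hy' : op q • y = 0 := congrArg Subtype.val hy
      obtain ⟨x, rfl⟩ := hY.1.2 q hq y hyY hy'
      refine ⟨⟨x, hi ?_⟩, rfl⟩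
      rw [i.map_smul, hy', i.map_zero]

/-- Annihilator cardinalities can be prescribed, subject to the constraints from endomorphism
rings and isomorphisms. -/
theorem exists_annCard_eq (P : Set (TwistedPoly φ)) (hP : ∀ p ∈ P, Irreducible p) (f : P → ℕ∞)
    (hf : ∀ q : P, f q = ⊤ ∨ ∃ n : ℕ, f q = ENat.card
      (Module.End (TwistedPoly φ)ᵐᵒᵖ (CyclicModule (q : TwistedPoly φ))) ^ n)
    (hf' : ∀ q q' : P, Nonempty (CyclicModule (q : TwistedPoly φ) ≃ₗ[(TwistedPoly φ)ᵐᵒᵖ]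
      CyclicModule (q' : TwistedPoly φ)) → f q = f q') :
    ∃ (M : Type u) (_ : AddCommGroup M) (_ : Module (TwistedPoly φ)ᵐᵒᵖ M),
      IsNonzeroDivisible (TwistedPoly φ) M ∧ ∀ q : P, annCard (q : TwistedPoly φ) M = f q := by
  classical
  have hι : ∀ q : P, ∃ ι : Type, ENat.card
      (ι → Module.End (TwistedPoly φ)ᵐᵒᵖ (CyclicModule (q : TwistedPoly φ))) = f q := by
    intro q
    have := isSimpleModule_cyclicModule (hP q q.2)
    rcases hf q with h | ⟨n, h⟩
    · have := IsSimpleModule.nontrivial (TwistedPoly φ)ᵐᵒᵖ (CyclicModule (q : TwistedPoly φ))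
      exact ⟨ℕ, by rw [h, ENat.card_eq_top_of_infinite]⟩
    · exact ⟨Fin n, by rw [h, ENat.card_fun]; simp⟩
  choose ι hι using hι
  let s : Setoid P :=
    { r := fun q q' => Nonempty (CyclicModule (q : TwistedPoly φ) ≃ₗ[(TwistedPoly φ)ᵐᵒᵖ]
        CyclicModule (q' : TwistedPoly φ))
      iseqv := ⟨fun _ => ⟨LinearEquiv.refl _ _⟩, fun ⟨e⟩ => ⟨e.symm⟩,
        fun ⟨e⟩ ⟨e'⟩ => ⟨e.trans e'⟩⟩ }
  obtain ⟨M, _, _, hM, hc⟩ := exists_divisible_extension_annCard (φ := φ)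
    -- One power of a simple module per isomorphism class, so isomorphic quotients are not counted
    -- twice. The factor $R$ is torsion-free: it ensures that the module is nonzero and adds nothing
    -- to annihilators.
    (TwistedPoly φ × (∀ c : Quotient s, ι c.out → CyclicModule (c.out : TwistedPoly φ)))
  refine ⟨M, _, _, hM, fun q => (hc q (hP q q.2)).trans ?_⟩
  let c₀ : Quotient s := Quotient.mk s q
  obtain ⟨e⟩ : Nonempty (CyclicModule (q : TwistedPoly φ) ≃ₗ[(TwistedPoly φ)ᵐᵒᵖ]
      CyclicModule (c₀.out : TwistedPoly φ)) := Setoid.symm (Quotient.mk_out (s := s) q)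
  rw [hf' q c₀.out ⟨e⟩, ← hι c₀.out, ENat.card_fun, ← annCard_eq_card_hom,
    ← annCard_eq_of_linearEquiv e, annCard, annCard,
    ← ENat.card_fun]
  refine ENat.card_congr (Equiv.ofBijective (fun x k => ⟨x.1.2 c₀ k, ?_⟩) ⟨?_, ?_⟩)
  · exact congrFun (congrFun (congrArg Prod.snd x.2) c₀) k
  · rintro ⟨⟨r, x⟩, hx⟩ ⟨⟨r', x'⟩, hx'⟩ h
    have hr : ∀ r : TwistedPoly φ, r * q = 0 → r = 0 := fun r h =>
      (mul_eq_zero.1 h).resolve_right (hP q q.2).ne_zero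
    have h1 : r = 0 := hr r (congrArg Prod.fst hx)
    have h1' : r' = 0 := hr r' (congrArg Prod.fst hx')
    refine Subtype.ext (Prod.ext (h1.trans h1'.symm) (funext fun c => funext fun k => ?_))
    by_cases hcc : c = c₀
    · subst hcc
      exact congrArg Subtype.val (congrFun h k)
    · have hemp : IsEmpty (CyclicModule (q : TwistedPoly φ) ≃ₗ[(TwistedPoly φ)ᵐᵒᵖ]
          CyclicModule (c.out : TwistedPoly φ)) := ⟨fun e => hcc (by
        rw [← Quotient.out_eq c]
        exact Quotient.sound ⟨e.symm⟩)⟩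
      have := annCard_cyclicModule_of_isEmpty (hP q q.2) (hP _ c.out.2) hemp
      exact congrArg Subtype.val (Subsingleton.elim
        (⟨x c k, congrFun (congrFun (congrArg Prod.snd hx) c) k⟩ :
          {y : CyclicModule (c.out : TwistedPoly φ) // op (q : TwistedPoly φ) • y = 0})
        ⟨x' c k, congrFun (congrFun (congrArg Prod.snd hx') c) k⟩)
  · intro g
    let y₀ : ι c₀.out → CyclicModule (c₀.out : TwistedPoly φ) := fun k => (g k).1
    let y : ∀ c : Quotient s, ι c.out → CyclicModule (c.out : TwistedPoly φ) := Pi.single c₀ y₀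
    have hy : op (q : TwistedPoly φ) • y = 0 := by
      have h0 : op (q : TwistedPoly φ) • y₀ = 0 := funext fun k => (g k).2
      rw [← Pi.single_smul, h0, Pi.single_zero]
    have hy₀ : y c₀ = y₀ := Pi.single_eq_same c₀ _
    refine ⟨⟨(0, y), Prod.ext (smul_zero _) hy⟩, funext fun k => Subtype.ext ?_⟩
    exact congrFun hy₀ k

end Construction

end RightModuleLang

/-! ### Completions and consistent specifications -/

namespace RightModuleLang

attribute [local instance] toStructure

open TwistedPoly

section Specified

variable {S : Type u} [Ring S]

theorem models_specifiedTheory {P : Set S} {f : P → ℕ∞} (M : Type v) [AddCommGroup M]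
    [Module Sᵐᵒᵖ M] :
    M ⊨ specifiedTheory P f ↔ IsNonzeroDivisible S M ∧ ∀ q : P, annCard (q : S) M = f q := by
  rw [specifiedTheory, Theory.model_union_iff, Theory.model_union_iff,
    models_nonzeroDivisibleTheory, and_assoc]
  refine and_congr_right fun _ => ?_
  constructor
  · rintro ⟨h1, h2⟩ q
    rw [Theory.model_iff] at h1 h2
    refine ENat.eq_of_forall_natCast_le_iff fun n => (realize_annGe M (q : S) n).symm.trans ?_
    refine ⟨fun h => ?_, fun h => h1 _ ⟨q, n, h, rfl⟩⟩
    by_contra hn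
    exact (Sentence.realize_not M).1 (h2 _ ⟨q, n, not_le.1 hn, rfl⟩) h
  · intro h
    constructor
    · rw [Theory.model_iff]
      rintro σ ⟨q, n, hn, rfl⟩
      exact (realize_annGe M (q : S) n).2 (hn.trans (h q).ge)
    · rw [Theory.model_iff]
      rintro σ ⟨q, n, hn, rfl⟩
      exact (Sentence.realize_not M).2 fun h' =>
        absurd ((realize_annGe M (q : S) n).1 h') (not_le.2 ((h q).trans_lt hn))

theorem moduleTheory_subset : moduleTheory S ⊆ nonzeroDivisibleTheory S :=
  Set.subset_union_left.trans Set.subset_union_left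

theorem nonzeroDivisibleTheory_subset (P : Set S) (f : P → ℕ∞) :
    nonzeroDivisibleTheory S ⊆ specifiedTheory P f :=
  Set.subset_union_left.trans Set.subset_union_left

/-- Every model of a theory of right modules comes from a right module. -/
theorem exists_module_of_modelType {T : (rightModuleLang S).Theory} (hT : moduleTheory S ⊆ T)
    (M : Theory.ModelType.{u, 0, u} T) :
    ∃ (N : Type u) (_ : AddCommGroup N) (_ : Module Sᵐᵒᵖ N) (_ : N ⊨ T),
      M = Theory.ModelType.of T N := by
  obtain ⟨N⟩ := M
  rename_i inst hN hne
  obtain ⟨g, m, rfl⟩ := exists_eq_toStructure N (hN.mono hT)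
  exact ⟨N, g, m, hN, rfl⟩

end Specified

section Completions

variable {K : Type u} [Field K] {φ : K →+* K} {P : Set (TwistedPoly φ)}

theorem annCard_eq_of_forall_mem (hP : IsSetOfRepresentatives P) {M : Type v} {N : Type w}
    [AddCommGroup M] [AddCommGroup N] [Module (TwistedPoly φ)ᵐᵒᵖ M] [Module (TwistedPoly φ)ᵐᵒᵖ N]
    (h : ∀ p : P, annCard (p : TwistedPoly φ) M = annCard (p : TwistedPoly φ) N)
    (q : TwistedPoly φ) (hq : Irreducible q) : annCard q M = annCard q N := by
  obtain ⟨p, ⟨hp, hpq⟩, -⟩ := hP.2 q hq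
  rw [annCard_eq_of_kConj hpq, annCard_eq_of_kConj hpq]
  exact h ⟨p, hp⟩

/-- The theory of a specification eliminates quantifiers, as does every larger theory. -/
theorem hasQE_of_specifiedTheory_subset (hP : IsSetOfRepresentatives P) {f : P → ℕ∞}
    {T : (rightModuleLang (TwistedPoly φ)).Theory} (hT : specifiedTheory P f ⊆ T) : HasQE T := by
  have hT' := moduleTheory_subset.trans ((nonzeroDivisibleTheory_subset P f).trans hT)
  refine hasQE_of_forall_realize T fun M N n v w h ψ => ?_
  obtain ⟨M, _, _, hM, rfl⟩ := exists_module_of_modelType hT' M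
  obtain ⟨N, _, _, hN, rfl⟩ := exists_module_of_modelType hT' N
  obtain ⟨hM1, hM2⟩ := (models_specifiedTheory M).1 (hM.mono hT)
  obtain ⟨hN1, hN2⟩ := (models_specifiedTheory N).1 (hN.mono hT)
  exact (realize_formula_iff hM1 hN1
    (annCard_eq_of_forall_mem hP fun q => (hM2 q).trans (hN2 q).symm) h ψ).1

theorem isMaximal_consequences_specifiedTheory (hP : IsSetOfRepresentatives P) {f : P → ℕ∞}
    (hf : (specifiedTheory P f).IsSatisfiable) : (consequences (specifiedTheory P f)).IsMaximal := by
  have hT' := moduleTheory_subset.trans (nonzeroDivisibleTheory_subset P f)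
  refine isMaximal_consequences hf fun M N σ => ?_
  obtain ⟨M, _, _, hM, rfl⟩ := exists_module_of_modelType hT' M
  obtain ⟨N, _, _, hN, rfl⟩ := exists_module_of_modelType hT' N
  obtain ⟨hM1, hM2⟩ := (models_specifiedTheory M).1 hM
  obtain ⟨hN1, hN2⟩ := (models_specifiedTheory N).1 hN
  exact (realize_sentence_iff hM1 hN1
    (annCard_eq_of_forall_mem hP fun q => (hM2 q).trans (hN2 q).symm) σ).1

theorem isSatisfiable_specifiedTheory_iff (hP : IsSetOfRepresentatives P) (f : P → ℕ∞) :
    (specifiedTheory P f).IsSatisfiable ↔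
      (∀ q : P, f q = ⊤ ∨ ∃ n : ℕ, f q = ENat.card
        (Module.End (TwistedPoly φ)ᵐᵒᵖ (CyclicModule (q : TwistedPoly φ))) ^ n) ∧
      ∀ q q' : P, Nonempty (CyclicModule (q : TwistedPoly φ)
          ≃ₗ[(TwistedPoly φ)ᵐᵒᵖ] CyclicModule (q' : TwistedPoly φ)) → f q = f q' := by
  constructor
  · rintro ⟨M⟩
    obtain ⟨M, _, _, hM, -⟩ := exists_module_of_modelType
      (moduleTheory_subset.trans (nonzeroDivisibleTheory_subset P f)) M
    obtain ⟨-, h⟩ := (models_specifiedTheory M).1 hM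
    refine ⟨fun q => ?_, fun q q' ⟨e⟩ => ?_⟩
    · rw [← h q]
      exact annCard_eq_top_or _ (hP.1 q q.2) M
    · rw [← h q, ← h q']
      exact annCard_eq_of_linearEquiv e M
  · rintro ⟨h1, h2⟩
    obtain ⟨M, _, _, h3, h4⟩ := exists_annCard_eq P hP.1 f h1 h2
    have hM : M ⊨ specifiedTheory P f := (models_specifiedTheory M).2 ⟨h3, h4⟩
    exact Theory.Model.isSatisfiable M

/-- The function is read off from a model $M$ of $T$. Both $T$ and the consequences of $T_f$ are
maximal with model $M$, so each is the full theory of $M$; and any other $g$ is also computed by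
$M$. -/
theorem existsUnique_eq_consequences (hP : IsSetOfRepresentatives P)
    {T : (rightModuleLang (TwistedPoly φ)).Theory}
    (hT : IsCompletion (nonzeroDivisibleTheory (TwistedPoly φ)) T) :
    ∃! f : P → ℕ∞, (∀ q, f q ∈ fixedFieldPowers φ) ∧ T = consequences (specifiedTheory P f) := by
  obtain ⟨M₀⟩ := hT.2.1
  obtain ⟨M, _, _, hM, -⟩ := exists_module_of_modelType (moduleTheory_subset.trans hT.1) M₀
  have hMd := models_nonzeroDivisibleTheory.1 (hM.mono hT.1)
  let f : P → ℕ∞ := fun q => annCard (q : TwistedPoly φ) M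
  have hMf : M ⊨ specifiedTheory P f := (models_specifiedTheory M).2 ⟨hMd, fun _ => rfl⟩
  refine ⟨f, ⟨fun q => annCard_mem_fixedFieldPowers _ M, ?_⟩, ?_⟩
  · have hmax := isMaximal_consequences_specifiedTheory hP (f := f)
      (Theory.Model.isSatisfiable M)
    have hMc : M ⊨ consequences (specifiedTheory P f) :=
      (Theory.model_iff _).2 fun σ hσ => hσ.realize_sentence M
    ext σ
    rw [mem_iff_realize_of_isMaximal hT.2 M hM, mem_iff_realize_of_isMaximal hmax M hMc]
  · rintro g ⟨-, hg⟩
    have hMg : M ⊨ specifiedTheory P g := hM.mono ((subset_consequences _).trans hg.ge)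
    exact funext fun q => (((models_specifiedTheory M).1 hMg).2 q).symm

end Completions

end RightModuleLang

theorem mainTheorem4 {K : Type u} [Field K] (φ : K →+* K)
    (P : Set (TwistedPoly φ)) (hP : TwistedPoly.IsSetOfRepresentatives P) :
    (∀ T : (rightModuleLang (TwistedPoly φ)).Theory,
      IsCompletion (RightModuleLang.nonzeroDivisibleTheory (TwistedPoly φ)) T →
        HasQE T ∧
        ∃! f : P → ℕ∞, (∀ q, f q ∈ TwistedPoly.fixedFieldPowers φ) ∧
          T = consequences (RightModuleLang.specifiedTheory P f)) ∧
    (∀ f : P → ℕ∞, (RightModuleLang.specifiedTheory P f).IsSatisfiable →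
      IsCompletion (RightModuleLang.nonzeroDivisibleTheory (TwistedPoly φ))
        (consequences (RightModuleLang.specifiedTheory P f))) ∧
    (∀ f : P → ℕ∞, (RightModuleLang.specifiedTheory P f).IsSatisfiable ↔
      (∀ q : P, f q = ⊤ ∨ ∃ n : ℕ, f q = ENat.card
        (Module.End (TwistedPoly φ)ᵐᵒᵖ (TwistedPoly.CyclicModule (q : TwistedPoly φ))) ^ n) ∧
      ∀ q q' : P, Nonempty (TwistedPoly.CyclicModule (q : TwistedPoly φ)
          ≃ₗ[(TwistedPoly φ)ᵐᵒᵖ] TwistedPoly.CyclicModule (q' : TwistedPoly φ)) →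
        f q = f q') := by
  refine ⟨fun T hT => ?_, fun f hf => ⟨?_, ?_⟩,
    RightModuleLang.isSatisfiable_specifiedTheory_iff hP⟩
  · have h := RightModuleLang.existsUnique_eq_consequences hP hT
    refine ⟨?_, h⟩
    obtain ⟨f, ⟨-, rfl⟩, -⟩ := h
    exact RightModuleLang.hasQE_of_specifiedTheory_subset hP (subset_consequences _)
  · exact (RightModuleLang.nonzeroDivisibleTheory_subset P f).trans (subset_consequences _)
  · exact RightModuleLang.isMaximal_consequences_specifiedTheory hP hf
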